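/- Let $\mathbb{F}_q$ be a finite field with $q$ elements, let $n\ge 1$ be an integer with $n\mid q-1$, let $g\ge 0$, and let $G$ be one of the algebraic groups $SL(n)$ or $GL(n)$ over $\mathbb{F}_q$. Let $\zeta\in\mathbb{F}_q$ be a primitive $n$-th root of unity, let $d$ be an integer with $\gcd(d,n)=1$, and put $\xi_n=\zeta^d\,\mathrm{Id}$, a central element of order $n$ in $G(\mathbb{F}_q)$. With $[A,B]=ABA^{-1}B^{-1}$, let $$U_G=\{(A_1,B_1,\dots,A_g,B_g)\in G^{2g} : [A_1,B_1]\cdots[A_g,B_g]=\xi_n\},$$ an affine scheme over $\mathbb{F}_q$ on which $G$ acts by simultaneous conjugation, and let $$\mathcal{M}^d_B(G)=U_G/\!/G=\operatorname{Spec}\,\mathbb{F}_q[U_G]^{G}$$ be the affine GIT quotient, where $\mathbb{F}_q[U_G]^{G}$ is the ring of invariants of the algebraic group $G$. Write $|G|=|G(\mathbb{F}_q)|$, let $\mathrm{Irr}(G(\mathbb{F}_q))$ be the set of irreducible complex characters of the finite group $G(\mathbb{F}_q)$, and put $$S_G=\sum_{\chi\in\mathrm{Irr}(G(\mathbb{F}_q))}\frac{|G|^{2g-2}}{\chi(1)^{2g-1}}\,\chi(\xi_n).$$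 Then the set of $\mathbb{F}_q$-rational points of $\mathcal{M}^d_B(G)$ is finite and $$\#\mathcal{M}^d_B(SL(n))(\mathbb{F}_q)=S_{SL(n)},\qquad \#\mathcal{M}^d_B(GL(n))(\mathbb{F}_q)=(q-1)\,S_{GL(n)}.$$ Moreover, for both groups, $$\frac{\#U_G(\mathbb{F}_q)}{|G(\mathbb{F}_q)|}=S_G.$$ -/

import Mathlib

universe u v

open Matrix

namespace CharVar

/-! ### The groups `SL(n)` and `GL(n)` as functors on commutative rings -/

/-- The two linear algebraic groups `SL(n)` and `GL(n)`. -/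
inductive LinGroup
  | SL
  | GL

/-- The group of `R`-points: all of `GL(n, R)` for `GL`, the matrices of determinant `1` for `SL`. -/
def LinGroup.points (G : LinGroup) (n : ℕ) (R : Type v) [CommRing R] :
    Subgroup (GeneralLinearGroup (Fin n) R) :=
  match G with
  | .SL => MonoidHom.ker GeneralLinearGroup.det
  | .GL => ⊤

/-- The matrix underlying an `R`-point. -/
def LinGroup.mat {G : LinGroup} {n : ℕ} {R : Type v} [CommRing R] (a : G.points n R) :
    Matrix (Fin n) (Fin n) R :=
  ((a : GeneralLinearGroup (Fin n) R) : Matrix (Fin n) (Fin n) R)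

/-! ### Twisted representations of a genus `g` surface group -/

/-- `[A₁, B₁] ⋯ [A_g, B_g]`, where `A_i = x (inl i)`, `B_i = x (inr i)` and
`[A, B] = A B A⁻¹ B⁻¹`. -/
def surfaceWord {Γ : Type v} [Group Γ] {g : ℕ} (x : Fin g ⊕ Fin g → Γ) : Γ :=
  (List.ofFn fun i : Fin g =>
    x (Sum.inl i) * x (Sum.inr i) * (x (Sum.inl i))⁻¹ * (x (Sum.inr i))⁻¹).prod

/-- The set `U(R)` of `2g`-tuples in `G(R)` with `[A₁, B₁] ⋯ [A_g, B_g] = c · Id`. -/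
def TwistedRep {K : Type u} [Field K] (G : LinGroup) (n g : ℕ) (c : K)
    (R : Type v) [CommRing R] [Algebra K R] : Type v :=
  {x : Fin g ⊕ Fin g → G.points n R //
    LinGroup.mat (surfaceWord x) = Matrix.scalar (Fin n) (algebraMap K R c)}

/-- Simultaneous conjugation by `h ∈ G(R)` on `U(R)`. -/
def TwistedRep.conj {K : Type u} [Field K] {G : LinGroup} {n g : ℕ} {c : K}
    {R : Type v} [CommRing R] [Algebra K R] (h : G.points n R) (x : TwistedRep G n g c R) :
    TwistedRep G n g c R :=
  ⟨fun s => h * x.1 s * h⁻¹, by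
    have e : surfaceWord (fun s => h * x.1 s * h⁻¹) = h * surfaceWord x.1 * h⁻¹ := by
      have := map_list_prod (MulAut.conj h)
        (List.ofFn fun i : Fin g =>
          x.1 (Sum.inl i) * x.1 (Sum.inr i) * (x.1 (Sum.inl i))⁻¹ * (x.1 (Sum.inr i))⁻¹)
      rw [List.map_ofFn] at this
      simp only [MulAut.conj_apply] at this
      unfold surfaceWord
      rw [this]
      congr 2
      funext i
      simp [Function.comp, mul_assoc]
    rw [e]
    have hx := x.2
    simp only [LinGroup.mat, Subgroup.coe_mul, Units.val_mul] at hx ⊢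
    rw [hx, ← (Matrix.scalar_commute (algebraMap K R c) (fun _ => Commute.all _ _) _).eq,
      mul_assoc, ← Units.val_mul, ← Subgroup.coe_mul, mul_inv_cancel]
    simp⟩

/-! ### The affine variety of twisted representations

Its coordinate ring is generated by the entries of the `2g` matrices and of their inverses. -/

/-- Coordinates: `inl (s, i, j)` is the `(i, j)` entry of the `s`-th matrix, `inr (s, i, j)` that of
its inverse. -/
abbrev Coord (n g : ℕ) : Type :=
  ((Fin g ⊕ Fin g) × Fin n × Fin n) ⊕ ((Fin g ⊕ Fin g) × Fin n × Fin n)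

section CoordinateRing

variable (K : Type u) [Field K] (n g : ℕ)

/-- The generic `s`-th matrix. -/
noncomputable def genMat (s : Fin g ⊕ Fin g) :
    Matrix (Fin n) (Fin n) (MvPolynomial (Coord n g) K) :=
  Matrix.of fun i j => MvPolynomial.X (Sum.inl (s, i, j))

/-- The generic inverse of the `s`-th matrix. -/
noncomputable def genInv (s : Fin g ⊕ Fin g) :
    Matrix (Fin n) (Fin n) (MvPolynomial (Coord n g) K) :=
  Matrix.of fun i j => MvPolynomial.X (Sum.inr (s, i, j))

/-- `[A₁, B₁] ⋯ [A_g, B_g]` for the generic matrices. -/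
noncomputable def genWord : Matrix (Fin n) (Fin n) (MvPolynomial (Coord n g) K) :=
  (List.ofFn fun i : Fin g =>
    genMat K n g (Sum.inl i) * genMat K n g (Sum.inr i) *
      genInv K n g (Sum.inl i) * genInv K n g (Sum.inr i)).prod

variable {K}

/-- The defining equations of `U`: invertibility of the matrices, determinant `1` if `G = SL`, and
`[A₁, B₁] ⋯ [A_g, B_g] = c · Id`. -/
def equations (G : LinGroup) (c : K) : Set (MvPolynomial (Coord n g) K) :=
  {p | ∃ s i j, p = (genMat K n g s * genInv K n g s - 1) i j} ∪
  {p | G = .SL ∧ ∃ s, p = (genMat K n g s).det - 1} ∪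
  {p | ∃ i j, p = genWord K n g i j - Matrix.scalar (Fin n) (MvPolynomial.C c) i j}

/-- The coordinate ring `K[U]`. -/
abbrev CoordRing (G : LinGroup) (c : K) : Type u :=
  MvPolynomial (Coord n g) K ⧸ Ideal.span (equations n g G c)

end CoordinateRing

section Eval

variable {K : Type u} [Field K] {G : LinGroup} {n g : ℕ} {c : K}
  {R : Type v} [CommRing R] [Algebra K R]

/-- Evaluation of polynomials in the coordinates at a point of `U(R)`. -/
noncomputable def polyEval (x : TwistedRep G n g c R) : MvPolynomial (Coord n g) K →ₐ[K] R :=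
  MvPolynomial.aeval fun v => match v with
    | Sum.inl (s, i, j) => LinGroup.mat (x.1 s) i j
    | Sum.inr (s, i, j) => LinGroup.mat (x.1 s)⁻¹ i j

theorem map_genMat (x : TwistedRep G n g c R) (s : Fin g ⊕ Fin g) :
    (polyEval x).mapMatrix (genMat K n g s) = LinGroup.mat (x.1 s) := by
  ext i j
  simp [genMat, polyEval]

theorem map_genInv (x : TwistedRep G n g c R) (s : Fin g ⊕ Fin g) :
    (polyEval x).mapMatrix (genInv K n g s) = LinGroup.mat (x.1 s)⁻¹ := by
  ext i j
  simp [genInv, polyEval]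

theorem mat_mul (a b : G.points n R) :
    LinGroup.mat (a * b) = LinGroup.mat a * LinGroup.mat b := rfl

theorem mat_one : LinGroup.mat (1 : G.points n R) = 1 := rfl

theorem map_genWord (x : TwistedRep G n g c R) :
    (polyEval x).mapMatrix (genWord K n g) = LinGroup.mat (surfaceWord x.1) := by
  let φ : G.points n R →* Matrix (Fin n) (Fin n) R :=
    { toFun := LinGroup.mat, map_one' := mat_one, map_mul' := mat_mul }
  have h : LinGroup.mat (surfaceWord x.1) = φ (surfaceWord x.1) := rfl
  rw [h, genWord, surfaceWord, map_list_prod, map_list_prod, List.map_ofFn, List.map_ofFn]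
  congr 2
  funext i
  simp only [Function.comp, map_mul, map_genMat, map_genInv]
  rfl

theorem polyEval_equations (x : TwistedRep G n g c R) (p : MvPolynomial (Coord n g) K)
    (hp : p ∈ Ideal.span (equations n g G c)) : polyEval x p = 0 := by
  suffices h : Ideal.span (equations n g G c) ≤ RingHom.ker (polyEval x) from h hp
  rw [Ideal.span_le]
  have key : ∀ (M : Matrix (Fin n) (Fin n) (MvPolynomial (Coord n g) K)) (i j : Fin n),
      polyEval x (M i j) = (polyEval x).mapMatrix M i j := fun _ _ _ => rfl
  rintro p ((⟨s, i, j, rfl⟩ | ⟨hG, s, rfl⟩) | ⟨i, j, rfl⟩)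
  · change polyEval x _ = 0
    rw [key, map_sub, map_mul, map_genMat, map_genInv, ← mat_mul, mul_inv_cancel, mat_one, map_one,
      sub_self]
    rfl
  · change polyEval x _ = 0
    subst hG
    rw [map_sub, map_one, AlgHom.map_det, map_genMat]
    have h : GeneralLinearGroup.det (x.1 s : GeneralLinearGroup (Fin n) R) = 1 := (x.1 s).2
    have h' := congrArg Units.val h
    rw [GeneralLinearGroup.val_det_apply, Units.val_one] at h'
    exact sub_eq_zero.mpr h'
  · change polyEval x _ = 0
    rw [map_sub, key, key, map_genWord, x.2]
    have : (polyEval x).mapMatrix (Matrix.scalar (Fin n) (MvPolynomial.C c)) =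
        Matrix.scalar (Fin n) (algebraMap K R c) := by
      ext a b
      by_cases hab : a = b
      · subst hab; simp [polyEval]
      · simp [hab]
    rw [this, sub_self]

/-- Evaluation of regular functions on `U` at a point of `U(R)`. -/
noncomputable def eval (x : TwistedRep G n g c R) : CoordRing n g G c →ₐ[K] R :=
  Ideal.Quotient.liftₐ _ (polyEval x) (polyEval_equations x)

end Eval

/-! ### The affine GIT quotient -/

/-- The ring of invariants `K[U]^G` of the algebraic group `G`: the regular functions `f` on `U` with
`f (h · x) = f x` for all `h ∈ G(R)`, `x ∈ U(R)` and all commutative `K`-algebras `R` (not only for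
the `K`-points of `G`). -/
noncomputable def invariants {K : Type u} [Field K] (G : LinGroup) (n g : ℕ) (c : K) :
    Subalgebra K (CoordRing n g G c) where
  carrier := {f | ∀ (R : Type u) [CommRing R] [Algebra K R]
    (h : G.points n R) (x : TwistedRep G n g c R), eval (x.conj h) f = eval x f}
  mul_mem' := fun ha hb R _ _ h x => by rw [map_mul, map_mul, ha R h x, hb R h x]
  add_mem' := fun ha hb R _ _ h x => by rw [map_add, map_add, ha R h x, hb R h x]
  algebraMap_mem' := fun r R _ _ h x => by rw [AlgHom.commutes, AlgHom.commutes]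

/-- The `K`-rational points of the twisted character variety
`{[A₁, B₁] ⋯ [A_g, B_g] = c · Id} // G = Spec K[U]^G`. -/
abbrev CharacterVarietyPoints {K : Type u} [Field K] (G : LinGroup) (n g : ℕ) (c : K) : Type u :=
  invariants G n g c →ₐ[K] K

/-! ### Irreducible characters of a finite group -/

/-- The set `Irr Γ` of characters of irreducible complex representations of `Γ`. -/
def Irr (Γ : Type v) [Group Γ] : Set (Γ → ℂ) :=
  {χ | ∃ (m : ℕ) (ρ : Representation ℂ Γ (Fin m → ℂ)), ρ.IsIrreducible ∧ χ = ρ.character}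

theorem irr_finite (Γ : Type v) [Group Γ] [Finite Γ] : (Irr Γ).Finite := by
  classical
  have := Fintype.ofFinite Γ
  have hcard : (Nat.card Γ : ℂ) ≠ 0 := Nat.cast_ne_zero.mpr Nat.card_pos.ne'
  let _ : Invertible (Nat.card Γ : ℂ) := invertibleOfNonzero hcard
  let B : (Γ → ℂ) → (Γ → ℂ) →ₗ[ℂ] ℂ := fun τ =>
    { toFun := fun f => (Nat.card Γ : ℂ)⁻¹ * ∑ a, f a * τ a⁻¹
      map_add' := fun f f' => by simp [add_mul, Finset.sum_add_distrib, mul_add]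
      map_smul' := fun r f => by
        simp only [Pi.smul_apply, smul_eq_mul, RingHom.id_apply, mul_assoc, ← Finset.mul_sum]
        ring }
  have hB : ∀ σ ∈ Irr Γ, ∀ τ ∈ Irr Γ, B τ σ = if σ = τ then 1 else 0 := by
    rintro _ ⟨m, ρ, hρ, rfl⟩ _ ⟨m', ρ', hρ', rfl⟩
    have h := Representation.char_orthonormal ρ ρ'
    have e : B ρ'.character ρ.character =
      (Nat.card Γ : ℂ)⁻¹ * ∑ a, ρ.character a * ρ'.character a⁻¹ := rfl
    rw [e, h]
    by_cases hn : Nonempty (ρ'.Equiv ρ)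
    · obtain ⟨φ⟩ := hn
      have := Representation.char_iso φ
      rw [if_pos ⟨φ⟩, if_pos this.symm]
    · rw [if_neg hn, if_neg]
      intro hc
      have h2 := Representation.char_orthonormal ρ ρ
      rw [if_neg hn, ← hc, h2, if_pos ⟨Representation.Equiv.refl ρ⟩] at h
      exact one_ne_zero h
  have hli : LinearIndependent ℂ (fun χ : Irr Γ => (χ : Γ → ℂ)) := by
    rw [linearIndependent_iff']
    intro s a hs χ hχ
    have h := congrArg (B χ.1) hs
    rw [map_sum, map_zero] at h
    simp only [map_smul, smul_eq_mul] at h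
    rw [Finset.sum_eq_single χ] at h
    · rw [hB _ χ.2 _ χ.2, if_pos rfl, mul_one] at h
      exact h
    · intro τ _ hne
      rw [hB _ τ.2 _ χ.2, if_neg (fun hc => hne (Subtype.ext hc)), mul_zero]
    · intro hc; exact absurd hχ hc
  exact hli.set_finite_of_isNoetherian

/-- `∑_{χ ∈ Irr Γ} |Γ|^{2g-2} / χ(1)^{2g-1} · χ(ξ)`, with integer exponents. -/
noncomputable def characterSum (Γ : Type v) [Group Γ] [Finite Γ] (g : ℕ) (ξ : Γ) : ℂ :=
  ∑ χ ∈ (irr_finite Γ).toFinset,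
    (Nat.card Γ : ℂ) ^ (2 * (g : ℤ) - 2) / χ 1 ^ (2 * (g : ℤ) - 1) * χ ξ

end CharVar

namespace CharVar

/-! ### Points of the variety of twisted representations as representations of a free group -/

/-! Put c = ζ^d, so that c^m = 1 forces n ∣ m. The surface word is a product of commutators, so
every determinant of it is 1. If it acts as the scalar c on a space of dimension m, then c^m = 1 and
n ∣ m. Hence a twisted representation cannot break into smaller pieces, either over a field or after
reduction modulo a valuation.

Over a finite or algebraically closed field, the values of a twisted representation therefore span
the whole matrix algebra (`algEquiv_matrix`, `span_range_eq_top`). Traces then determine it up to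
`GL(n)`-conjugation (`exists_conj_of_trace_eq`), and its stabilizer consists of scalars.

Every K-point φ of the quotient comes from U(K). A valuation ring V of a field L over K[U] dominates
φ (`exists_valuationSubring_dominating`). The universal representation over L has V-integral
invariants, and the determinant remark shows that the V-span of an orbit is a lattice
(`exists_conj_integral`). Reducing it gives a point over an algebraically closed field on which the
invariants take the values φ. Its traces lie in K, so its K-span is a copy of M_n(K), there being no
division algebras over a finite field to obstruct this. Skolem–Noether then conjugates the point
into U(K) (`exists_rational_point`).

The fibres of U(K) over the quotient are thus `GL(n, K)`-orbits with stabilizer Kˣ, for `SL` as well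
as `GL`, so (q-1)·#U(K) = |GL(n, K)|·#M(K) (`card_units_mul_card_twistedRep`). Frobenius' formula
(`card_surfaceWord_div`) evaluates #U(K)/|G(K)|: a sum of ρ over all commutators is scalar by
Schur's lemma, and the regular character picks out the solutions. -/

theorem map_surfaceWord {Γ Γ' : Type*} [Group Γ] [Group Γ'] {g : ℕ} (f : Γ →* Γ')
    (x : Fin g ⊕ Fin g → Γ) : f (surfaceWord x) = surfaceWord (f ∘ x) := by
  rw [surfaceWord, surfaceWord, map_list_prod, List.map_ofFn]
  congr 2
  funext i
  simp [Function.comp]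

/-- Commutators die in a commutative group. A monoid is allowed as target so that determinants
qualify; the values land in its units anyway. -/
theorem map_surfaceWord_eq_one {Γ C : Type*} [Group Γ] [CommMonoid C] {g : ℕ} (f : Γ →* C)
    (x : Fin g ⊕ Fin g → Γ) : f (surfaceWord x) = 1 := by
  have h : f.toHomUnits (surfaceWord x) = 1 := by
    rw [map_surfaceWord, surfaceWord]
    apply List.prod_eq_one
    intro a ha
    obtain ⟨i, rfl⟩ := (List.mem_ofFn' _ _).mp ha
    simp
  exact congrArg Units.val h

section Points

variable {K : Type u} [Field K] {G : LinGroup} {n g : ℕ} {c : K}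
  {R : Type v} [CommRing R] [Algebra K R]

theorem LinGroup.mem_points_iff (h : GeneralLinearGroup (Fin n) R) :
    h ∈ G.points n R ↔ (G = .SL → (h : Matrix (Fin n) (Fin n) R).det = 1) := by
  cases G
  · simp [LinGroup.points, MonoidHom.mem_ker, Units.ext_iff]
  · simp [LinGroup.points]

/-- The inclusion of `G(R)` into the monoid of matrices. -/
def LinGroup.matHom (G : LinGroup) (n : ℕ) (R : Type v) [CommRing R] :
    G.points n R →* Matrix (Fin n) (Fin n) R where
  toFun := LinGroup.mat
  map_one' := rfl
  map_mul' _ _ := rfl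

theorem LinGroup.mat_injective : Function.Injective (LinGroup.mat (G := G) (n := n) (R := R)) :=
  fun _ _ h => Subtype.ext (Units.ext h)

namespace TwistedRep

/-- The word in the free group whose value is prescribed. -/
def word (g : ℕ) : FreeGroup (Fin g ⊕ Fin g) := surfaceWord FreeGroup.of

/-- The matrix representation of the free group attached to a point. -/
def rep (x : TwistedRep G n g c R) :
    FreeGroup (Fin g ⊕ Fin g) →* Matrix (Fin n) (Fin n) R :=
  (LinGroup.matHom G n R).comp (FreeGroup.lift x.1)

theorem rep_of (x : TwistedRep G n g c R) (s : Fin g ⊕ Fin g) :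
    x.rep (FreeGroup.of s) = LinGroup.mat (x.1 s) := by
  simp [rep]
  rfl

theorem rep_inv_of (x : TwistedRep G n g c R) (s : Fin g ⊕ Fin g) :
    x.rep (FreeGroup.of s)⁻¹ = LinGroup.mat (x.1 s)⁻¹ := by
  simp [rep]
  rfl

theorem rep_word (x : TwistedRep G n g c R) :
    x.rep (word g) = Matrix.scalar (Fin n) (algebraMap K R c) := by
  rw [← x.2]
  change LinGroup.mat (FreeGroup.lift x.1 (surfaceWord FreeGroup.of)) = _
  rw [map_surfaceWord]
  congr 2
  funext s
  simp

theorem det_rep_of (x : TwistedRep G n g c R) (hG : G = .SL) (s : Fin g ⊕ Fin g) :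
    (x.rep (FreeGroup.of s)).det = 1 := by
  rw [rep_of]
  exact (LinGroup.mem_points_iff _).mp (x.1 s).2 hG

theorem ext_rep {x y : TwistedRep G n g c R}
    (h : ∀ s, x.rep (FreeGroup.of s) = y.rep (FreeGroup.of s)) : x = y := by
  apply Subtype.ext
  funext s
  apply LinGroup.mat_injective
  rw [← rep_of, ← rep_of, h]

theorem mat_lift_eq {p : Fin g ⊕ Fin g → G.points n R}
    {r : FreeGroup (Fin g ⊕ Fin g) →* Matrix (Fin n) (Fin n) R}
    (h : ∀ s, LinGroup.mat (p s) = r (FreeGroup.of s)) (w : FreeGroup (Fin g ⊕ Fin g)) :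
    LinGroup.mat (FreeGroup.lift p w) = r w := by
  have : (LinGroup.matHom G n R).comp (FreeGroup.lift p) = r := FreeGroup.ext_hom _ _ fun a => by
    rw [MonoidHom.comp_apply, FreeGroup.lift_apply_of]
    exact h a
  exact DFunLike.congr_fun this w

/-- The point attached to a matrix representation of the free group. -/
def ofRep (r : FreeGroup (Fin g ⊕ Fin g) →* Matrix (Fin n) (Fin n) R)
    (hdet : G = .SL → ∀ s, (r (FreeGroup.of s)).det = 1)
    (hr : r (word g) = Matrix.scalar (Fin n) (algebraMap K R c)) : TwistedRep G n g c R :=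
  ⟨fun s => ⟨r.toHomUnits (FreeGroup.of s),
    (LinGroup.mem_points_iff _).mpr fun h => hdet h s⟩, by
    rw [← hr, ← mat_lift_eq (G := G) (p := fun s => ⟨r.toHomUnits (FreeGroup.of s),
      (LinGroup.mem_points_iff _).mpr fun h => hdet h s⟩) (fun _ => rfl), word,
      map_surfaceWord]
    congr 2
    funext s
    simp⟩

theorem rep_ofRep (r : FreeGroup (Fin g ⊕ Fin g) →* Matrix (Fin n) (Fin n) R)
    (hdet : G = .SL → ∀ s, (r (FreeGroup.of s)).det = 1)
    (hr : r (word g) = Matrix.scalar (Fin n) (algebraMap K R c)) :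
    (ofRep r hdet hr).rep = r :=
  FreeGroup.ext_hom _ _ fun s => by
    rw [rep_of]
    rfl

variable {R' : Type*} [CommRing R'] [Algebra K R']

theorem mapMatrix_scalar (θ : R →ₐ[K] R') (c : K) :
    θ.mapMatrix (Matrix.scalar (Fin n) (algebraMap K R c)) =
      Matrix.scalar (Fin n) (algebraMap K R' c) := by
  ext a b
  by_cases hab : a = b
  · subst hab; simp
  · simp [hab]

/-- Base change of a point. -/
def map (θ : R →ₐ[K] R') (x : TwistedRep G n g c R) : TwistedRep G n g c R' :=
  ofRep ((MonoidHomClass.toMonoidHom (θ.mapMatrix (m := Fin n))).comp x.rep)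
    (fun hG s => by
      change (θ.mapMatrix (x.rep (FreeGroup.of s))).det = 1
      rw [← AlgHom.map_det, x.det_rep_of hG, map_one])
    (by
      change θ.mapMatrix (x.rep (word g)) = _
      rw [rep_word, mapMatrix_scalar])

theorem rep_map (θ : R →ₐ[K] R') (x : TwistedRep G n g c R) (w : FreeGroup (Fin g ⊕ Fin g)) :
    (x.map θ).rep w = θ.mapMatrix (x.rep w) := by
  rw [map, rep_ofRep]
  rfl

theorem rep_conj (h : G.points n R) (x : TwistedRep G n g c R)
    (w : FreeGroup (Fin g ⊕ Fin g)) :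
    (x.conj h).rep w = LinGroup.mat h * x.rep w * LinGroup.mat h⁻¹ := by
  have : FreeGroup.lift (x.conj h).1 =
      ((MulAut.conj h).toMonoidHom).comp (FreeGroup.lift x.1) := by
    apply FreeGroup.ext_hom
    intro s
    simp [conj]
  change LinGroup.mat (FreeGroup.lift (x.conj h).1 w) = _
  rw [this]
  rfl

end TwistedRep

open TwistedRep

theorem eval_mk_X_inl (x : TwistedRep G n g c R) (s : Fin g ⊕ Fin g) (i j : Fin n) :
    eval x (Ideal.Quotient.mk _ (MvPolynomial.X (Sum.inl (s, i, j)))) =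
      x.rep (FreeGroup.of s) i j := by
  rw [rep_of, ← Ideal.Quotient.mkₐ_eq_mk K, ← AlgHom.comp_apply, eval,
    Ideal.Quotient.liftₐ_comp]
  simp [polyEval]

theorem eval_mk_X_inr (x : TwistedRep G n g c R) (s : Fin g ⊕ Fin g) (i j : Fin n) :
    eval x (Ideal.Quotient.mk _ (MvPolynomial.X (Sum.inr (s, i, j)))) =
      x.rep (FreeGroup.of s)⁻¹ i j := by
  rw [rep_inv_of, ← Ideal.Quotient.mkₐ_eq_mk K, ← AlgHom.comp_apply, eval,
    Ideal.Quotient.liftₐ_comp]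
  simp [polyEval]

theorem coordRing_algHom_ext {ψ ψ' : CoordRing n g G c →ₐ[K] R}
    (h : ∀ v, ψ (Ideal.Quotient.mk _ (MvPolynomial.X v)) =
      ψ' (Ideal.Quotient.mk _ (MvPolynomial.X v))) : ψ = ψ' :=
  Ideal.Quotient.algHom_ext _ (MvPolynomial.algHom_ext h)

theorem eval_map {R' : Type*} [CommRing R'] [Algebra K R'] (θ : R →ₐ[K] R')
    (x : TwistedRep G n g c R) : eval (x.map θ) = θ.comp (eval x) := by
  apply coordRing_algHom_ext
  rintro (⟨s, i, j⟩ | ⟨s, i, j⟩)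
  · rw [AlgHom.comp_apply, eval_mk_X_inl, eval_mk_X_inl, rep_map]
    rfl
  · rw [AlgHom.comp_apply, eval_mk_X_inr, eval_mk_X_inr, rep_map]
    rfl

/-! ### The universal point: K[U] represents the functor R ↦ U(R). -/

section Universal

variable (G n g c)

theorem mk_equation {p : MvPolynomial (Coord n g) K} (hp : p ∈ equations n g G c) :
    Ideal.Quotient.mkₐ K (Ideal.span (equations n g G c)) p = 0 :=
  Ideal.Quotient.eq_zero_iff_mem.mpr (Ideal.subset_span hp)

/-- The universal `s`-th matrix. -/
noncomputable def universalPoint (s : Fin g ⊕ Fin g) : G.points n (CoordRing n g G c) :=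
  let q := (Ideal.Quotient.mkₐ K (Ideal.span (equations n g G c))).mapMatrix (m := Fin n)
  have h : q (genMat K n g s) * q (genInv K n g s) = 1 := by
    rw [← map_mul, ← sub_eq_zero, ← map_one q, ← map_sub]
    ext i j
    exact mk_equation G n g c (Or.inl (Or.inl ⟨s, i, j, rfl⟩))
  ⟨⟨q (genMat K n g s), q (genInv K n g s), h, mul_eq_one_comm.mp h⟩,
    (LinGroup.mem_points_iff _).mpr fun hG => by
      change (q (genMat K n g s)).det = 1
      rw [← AlgHom.map_det, ← sub_eq_zero,
        ← map_one (Ideal.Quotient.mkₐ K (Ideal.span (equations n g G c))), ← map_sub]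
      exact mk_equation G n g c (Or.inl (Or.inr ⟨hG, s, rfl⟩))⟩

/-- The universal twisted representation. -/
noncomputable def universal : TwistedRep G n g c (CoordRing n g G c) :=
  ⟨universalPoint G n g c, by
    have h : LinGroup.mat (surfaceWord (universalPoint G n g c)) =
        (Ideal.Quotient.mkₐ K (Ideal.span (equations n g G c))).mapMatrix (genWord K n g) := by
      change LinGroup.matHom _ _ _ _ = _
      rw [genWord, surfaceWord, map_list_prod, map_list_prod, List.map_ofFn, List.map_ofFn]
      congr 2
      funext i
      simp only [Function.comp, map_mul]
      rfl
    rw [h, ← TwistedRep.mapMatrix_scalar (Ideal.Quotient.mkₐ K _), ← sub_eq_zero, ← map_sub]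
    ext i j
    exact mk_equation G n g c (Or.inr ⟨i, j, rfl⟩)⟩

theorem eval_universal : eval (universal G n g c) = AlgHom.id K _ := by
  apply coordRing_algHom_ext
  rintro (⟨s, i, j⟩ | ⟨s, i, j⟩)
  · rw [eval_mk_X_inl, rep_of]
    rfl
  · rw [eval_mk_X_inr, rep_inv_of]
    rfl

end Universal

theorem eval_map_universal (ψ : CoordRing n g G c →ₐ[K] R) :
    eval ((universal G n g c).map ψ) = ψ := by
  rw [eval_map, eval_universal]
  rfl

theorem eval_injective :
    Function.Injective (eval : TwistedRep G n g c R → CoordRing n g G c →ₐ[K] R) := by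
  intro x y h
  apply ext_rep
  intro s
  ext i j
  rw [← eval_mk_X_inl, ← eval_mk_X_inl, h]

theorem map_eval_universal (x : TwistedRep G n g c R) :
    (universal G n g c).map (eval x) = x :=
  eval_injective (eval_map_universal _)

theorem mapMatrix_eval_rep_universal (x : TwistedRep G n g c R)
    (w : FreeGroup (Fin g ⊕ Fin g)) :
    (eval x).mapMatrix ((universal G n g c).rep w) = x.rep w := by
  rw [← rep_map, map_eval_universal]

end Points

/-! ### Invariant functions -/

section GenDet

variable {n : ℕ} {ι : Type*} [Fintype ι] {R : Type*} [CommRing R]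

/-- The polynomial `det (1 - ∑ tᵢ Mᵢ)`. -/
noncomputable def genDet (M : ι → Matrix (Fin n) (Fin n) R) : MvPolynomial (ι) R :=
  (1 - ∑ i, (MvPolynomial.X i : MvPolynomial (ι) R) •
    (MvPolynomial.C : R →+* _).mapMatrix (M i)).det

theorem map_genDet {R' : Type*} [CommRing R'] (θ : R →+* R')
    (M : ι → Matrix (Fin n) (Fin n) R) :
    MvPolynomial.map θ (genDet M) = genDet fun i => θ.mapMatrix (M i) := by
  rw [genDet, genDet, RingHom.map_det, map_sub, map_one, map_sum]
  congr 2
  refine Finset.sum_congr rfl fun i _ => ?_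
  ext a b
  simp

/-- 1 - ∑ tᵢ P Mᵢ Q = P (1 - ∑ tᵢ Mᵢ) Q. -/
theorem genDet_conj (P Q : Matrix (Fin n) (Fin n) R) (h : P * Q = 1)
    (M : ι → Matrix (Fin n) (Fin n) R) : genDet (fun i => P * M i * Q) = genDet M := by
  let C' : Matrix (Fin n) (Fin n) R →+* Matrix (Fin n) (Fin n) (MvPolynomial (ι) R) :=
    (MvPolynomial.C : R →+* _).mapMatrix
  have hC : C' P * C' Q = 1 := by rw [← map_mul, h, map_one]
  have e : (1 - ∑ i, (MvPolynomial.X i : MvPolynomial (ι) R) • C' (P * M i * Q)) =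
      C' P * (1 - ∑ i, (MvPolynomial.X i : MvPolynomial (ι) R) • C' (M i)) * C' Q := by
    rw [mul_sub, sub_mul, mul_one, hC, Finset.mul_sum, Finset.sum_mul]
    simp only [map_mul, Matrix.mul_smul, Matrix.smul_mul]
  change det _ = det _
  rw [e, det_mul, det_mul, mul_right_comm, ← det_mul, hC, det_one, one_mul]

theorem eval_genDet (M : ι → Matrix (Fin n) (Fin n) R) (t : ι → R) :
    MvPolynomial.eval t (genDet M) = (1 - ∑ i, t i • M i).det := by
  rw [genDet, RingHom.map_det, map_sub, map_one, map_sum]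
  congr 2
  refine Finset.sum_congr rfl fun i _ => ?_
  ext a b
  simp

end GenDet

section Invariants

variable {K : Type u} [Field K] {G : LinGroup} {n g : ℕ} {c : K}

open TwistedRep

theorem mat_mul_mat_inv {R : Type v} [CommRing R] (h : G.points n R) :
    LinGroup.mat h * LinGroup.mat h⁻¹ = 1 := by
  rw [← mat_mul, mul_inv_cancel, mat_one]

theorem trace_mem_invariants (w : FreeGroup (Fin g ⊕ Fin g)) :
    ((universal G n g c).rep w).trace ∈ invariants G n g c := by
  intro R _ _ h x
  have key : ∀ y : TwistedRep G n g c R,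
      eval y ((universal G n g c).rep w).trace = (y.rep w).trace := by
    intro y
    rw [← mapMatrix_eval_rep_universal y w]
    exact AddMonoidHom.map_trace (eval y) _
  rw [key, key, rep_conj, Matrix.trace_mul_comm, ← mul_assoc, mul_eq_one_comm.mp
    (mat_mul_mat_inv h), one_mul]

theorem eval_trace {R : Type v} [CommRing R] [Algebra K R] (x : TwistedRep G n g c R)
    (w : FreeGroup (Fin g ⊕ Fin g)) :
    eval x ((universal G n g c).rep w).trace = (x.rep w).trace := by
  rw [← mapMatrix_eval_rep_universal x w]
  exact AddMonoidHom.map_trace (eval x) _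

theorem eval_coeff_genDet {R : Type v} [CommRing R] [Algebra K R] (x : TwistedRep G n g c R)
    {ι : Type*} [Fintype ι] (w : ι → FreeGroup (Fin g ⊕ Fin g)) (m : ι →₀ ℕ) :
    eval x ((genDet fun i => (universal G n g c).rep (w i)).coeff m) =
      (genDet fun i => x.rep (w i)).coeff m := by
  have := map_genDet (eval x : CoordRing n g G c →+* R) fun i => (universal G n g c).rep (w i)
  have h2 : (fun i => (eval x : CoordRing n g G c →+* R).mapMatrix
      ((universal G n g c).rep (w i))) = fun i => x.rep (w i) := by
    funext i
    exact mapMatrix_eval_rep_universal x (w i)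
  rw [h2] at this
  rw [← this, MvPolynomial.coeff_map]
  rfl

/-- Traces suffice to separate representations, but the lattice argument needs these finer
invariants: their integrality controls det (1 - ∑ μᵢ Mᵢ) in every characteristic. -/
theorem coeff_genDet_mem_invariants {ι : Type*} [Fintype ι]
    (w : ι → FreeGroup (Fin g ⊕ Fin g))
    (m : ι →₀ ℕ) :
    (genDet fun i => (universal G n g c).rep (w i)).coeff m ∈ invariants G n g c := by
  intro R _ _ h x
  rw [eval_coeff_genDet, eval_coeff_genDet]
  simp only [rep_conj]
  rw [genDet_conj _ _ (mat_mul_mat_inv h)]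

/-- Invariants of `SL(n)` or `GL(n)` take equal values at points over a field that are conjugate
under `GL(n)`. -/
theorem eval_eq_of_conj {F : Type u} [Field F] [Algebra K F] (hn : n ≠ 0)
    (x y : TwistedRep G n g c F) (P Q : Matrix (Fin n) (Fin n) F) (hPQ : P * Q = 1)
    (h : ∀ s, y.rep (FreeGroup.of s) = P * x.rep (FreeGroup.of s) * Q)
    (f : CoordRing n g G c) (hf : f ∈ invariants G n g c) : eval y f = eval x f := by
  let E := AlgebraicClosure F
  let ι : F →ₐ[K] E := IsScalarTower.toAlgHom K F E
  have hι : Function.Injective ι := (algebraMap F E).injective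
  have hdet : P.det ≠ 0 := by
    intro h0
    have := congrArg det hPQ
    rw [det_mul, h0, zero_mul, det_one] at this
    exact zero_ne_one this
  -- Dividing P by an n-th root of its determinant puts the conjugator in `SL(n)` over the algebraic
  -- closure and leaves the conjugation unchanged. This uses invariance over extensions of K, not
  -- only under K-points.
  obtain ⟨s, hs⟩ := IsAlgClosed.exists_pow_nat_eq (ι P.det) (Nat.pos_of_ne_zero hn)
  have hs0 : s ≠ 0 := by
    rintro rfl
    rw [zero_pow hn] at hs
    exact hdet (hι (by rw [← hs, map_zero]))
  have hPQ' : (s⁻¹ • ι.mapMatrix P) * (s • ι.mapMatrix Q) = 1 := by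
    rw [Matrix.smul_mul, Matrix.mul_smul, smul_smul, inv_mul_cancel₀ hs0, one_smul, ← map_mul,
      hPQ, map_one]
  let k : G.points n E := ⟨⟨_, _, hPQ', mul_eq_one_comm.mp hPQ'⟩,
    (LinGroup.mem_points_iff _).mpr fun _ => by
      change (s⁻¹ • ι.mapMatrix P).det = 1
      rw [det_smul, Fintype.card_fin, ← AlgHom.map_det, ← hs, ← mul_pow, inv_mul_cancel₀ hs0,
        one_pow]⟩
  have hy : y.map ι = (x.map ι).conj k := by
    apply ext_rep
    intro a
    rw [rep_conj, rep_map, rep_map, h, map_mul, map_mul]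
    change _ = (s⁻¹ • ι.mapMatrix P) * _ * (s • ι.mapMatrix Q)
    rw [Matrix.smul_mul, Matrix.smul_mul, Matrix.mul_smul, smul_smul, inv_mul_cancel₀ hs0,
      one_smul]
  apply hι
  have := hf E k (x.map ι)
  rw [← hy, eval_map, eval_map] at this
  exact this

end Invariants

open TwistedRep

/-! ### Algebras generated by twisted representations are matrix algebras -/

section MatrixAlgebra

variable {F : Type*} [Field F] {Λ : Type*} [Ring Λ] [Algebra F Λ] [Module.Finite F Λ] {n g : ℕ}
  {c : F}

/-- The word has determinant 1 in M_d(D) and equals c there, so c^d = 1 and n ∣ d. Then d²·[D : F] ≤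
dim Λ ≤ n² ≤ d² forces d = n, D = F and π injective. -/
theorem algEquiv_matrix_of_surjective {D : Type*} [Field D] [Algebra F D] [Module.Finite F D]
    {d : ℕ} (hd : d ≠ 0) (hdim : Module.finrank F Λ ≤ n ^ 2) (hc : ∀ m : ℕ, c ^ m = 1 → n ∣ m)
    (r : FreeGroup (Fin g ⊕ Fin g) →* Λ) (hr : r (word g) = algebraMap F Λ c)
    (π : Λ →ₐ[F] Matrix (Fin d) (Fin d) D) (hπ : Function.Surjective π) :
    Nonempty (Λ ≃ₐ[F] Matrix (Fin n) (Fin n) F) := by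
  have h1 : (π (r (word g))).det = 1 :=
    map_surfaceWord_eq_one
      ((detMonoidHom (n := Fin d) (R := D)).comp ((π : Λ →* Matrix (Fin d) (Fin d) D).comp r)) _
  rw [hr, AlgHom.commutes, IsScalarTower.algebraMap_apply F D, Matrix.algebraMap_eq_diagonal,
    Matrix.det_diagonal] at h1
  simp only [Pi.algebraMap_apply, Algebra.algebraMap_self, RingHom.id_apply, Finset.prod_const,
    Finset.card_univ, Fintype.card_fin] at h1
  rw [← map_pow, ← map_one (algebraMap F D)] at h1
  have hnd : n ≤ d := Nat.le_of_dvd (Nat.pos_of_ne_zero hd)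
    (hc d ((algebraMap F D).injective h1))
  have hle := LinearMap.finrank_le_finrank_of_surjective (f := π.toLinearMap) hπ
  rw [Module.finrank_matrix, Fintype.card_fin] at hle
  have hD : 0 < Module.finrank F D := Module.finrank_pos
  have h2 : d * d * Module.finrank F D ≤ n * n := by rw [← sq n]; exact hle.trans hdim
  have h3 : n * n ≤ d * d := Nat.mul_le_mul hnd hnd
  have h4 : d * d * Module.finrank F D ≤ d * d := h2.trans h3
  have hdd : 0 < d * d := Nat.mul_pos (Nat.pos_of_ne_zero hd) (Nat.pos_of_ne_zero hd)
  have h5 : Module.finrank F D = 1 := by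
    refine le_antisymm ?_ hD
    by_contra! h
    nlinarith
  have h6 : d = n := by
    refine le_antisymm ?_ hnd
    by_contra! h
    rw [h5] at h2
    nlinarith
  subst h6
  have hfr : Module.finrank F Λ = Module.finrank F (Matrix (Fin d) (Fin d) D) := by
    refine le_antisymm ?_ (LinearMap.finrank_le_finrank_of_surjective (f := π.toLinearMap) hπ)
    rw [Module.finrank_matrix, Fintype.card_fin, h5, mul_one, ← sq]
    exact hdim
  have hinj : Function.Injective π :=
    (LinearMap.injective_iff_surjective_of_finrank_eq_finrank (f := π.toLinearMap) hfr).mpr hπ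
  have hb : Function.Bijective (Algebra.ofId F D) :=
    bijective_algebraMap_of_linearEquiv (Module.nonempty_linearEquiv_of_finrank_eq_one h5).some
  exact ⟨(AlgEquiv.ofBijective π ⟨hinj, hπ⟩).trans (AlgEquiv.ofBijective _ hb).symm.mapMatrix⟩

/-- Applies the preceding squeeze to a simple factor of Λ modulo its radical. Its division algebra
is commutative because F is algebraically closed, or by Wedderburn's little theorem when F is
finite. -/
theorem algEquiv_matrix [Nontrivial Λ] (hF : IsAlgClosed F ∨ Finite F)
    (hdim : Module.finrank F Λ ≤ n ^ 2) (hc : ∀ m : ℕ, c ^ m = 1 → n ∣ m)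
    (r : FreeGroup (Fin g ⊕ Fin g) →* Λ) (hr : r (word g) = algebraMap F Λ c) :
    Nonempty (Λ ≃ₐ[F] Matrix (Fin n) (Fin n) F) := by
  have : IsArtinianRing Λ := IsArtinianRing.of_finite F Λ
  obtain ⟨k, D, d, _, _, _, hd, ⟨e⟩⟩ :=
    IsSemisimpleRing.exists_algEquiv_pi_matrix_divisionRing_finite F (Λ ⧸ Ring.jacobson Λ)
  have hk : Nonempty (Fin k) := by
    by_contra h
    rw [not_nonempty_iff] at h
    have : Subsingleton (Λ ⧸ Ring.jacobson Λ) := e.injective.subsingleton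
    have := Ideal.Quotient.subsingleton_iff.mp this
    exact (Ring.jacobson_lt_top Λ).ne this
  obtain ⟨i⟩ := hk
  have hcomm : ∀ a b : D i, a * b = b * a := by
    rcases hF with hF | hF
    · intro a b
      obtain ⟨a, rfl⟩ := (IsAlgClosed.algebraMap_bijective_of_isIntegral (k := F) (K := D i)).2 a
      exact Algebra.commutes a b
    · have : Finite (D i) := Module.finite_of_finite F
      exact (littleWedderburn (D i)).mul_comm
  let _ : Field (D i) := { (inferInstance : DivisionRing (D i)) with mul_comm := hcomm }
  let π : Λ →ₐ[F] Matrix (Fin (d i)) (Fin (d i)) (D i) :=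
    ((Pi.evalAlgHom F (fun i => Matrix (Fin (d i)) (Fin (d i)) (D i)) i).comp
      (e : (Λ ⧸ Ring.jacobson Λ) →ₐ[F] _)).comp (Ideal.Quotient.mkₐ F (Ring.jacobson Λ))
  refine algEquiv_matrix_of_surjective (hd i).ne hdim hc r hr π ?_
  intro y
  obtain ⟨z, hz⟩ := e.surjective (fun j => Function.update (β := fun j =>
    Matrix (Fin (d j)) (Fin (d j)) (D j)) 0 i y j)
  obtain ⟨a, rfl⟩ := Ideal.Quotient.mk_surjective z
  refine ⟨a, ?_⟩
  exact (congrFun hz i).trans (Function.update_self ..)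

end MatrixAlgebra

section Span

variable {F : Type*} [Field F] {n g : ℕ} {c : F}

/-- The algebra spanned by the values of a matrix representation of a group. -/
def spanAlgebra (F : Type*) [Field F] {Γ : Type*} [Group Γ] {M : Type*} [Ring M] [Algebra F M]
    (r : Γ →* M) : Subalgebra F M :=
  Algebra.adjoin F (Set.range r)

theorem spanAlgebra_toSubmodule {Γ : Type*} [Group Γ] {M : Type*} [Ring M] [Algebra F M]
    (r : Γ →* M) :
    Subalgebra.toSubmodule (spanAlgebra F r) = Submodule.span F (Set.range r) := by
  rw [spanAlgebra, Algebra.adjoin_eq_span]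
  congr 1
  have : Set.range r = (MonoidHom.mrange r : Set M) := rfl
  rw [this, Submonoid.closure_eq]

/-- The corestriction of a representation to the algebra spanned by its values. -/
def toSpanAlgebra {Γ : Type*} [Group Γ] {M : Type*} [Ring M] [Algebra F M]
    (r : Γ →* M) : Γ →* spanAlgebra F r :=
  r.codRestrict (spanAlgebra F r) fun a => Algebra.subset_adjoin ⟨a, rfl⟩

/-- A twisted representation over an algebraically closed or finite field is absolutely
irreducible. -/
theorem span_range_eq_top (hF : IsAlgClosed F ∨ Finite F) (hn : n ≠ 0)
    (hc : ∀ m : ℕ, c ^ m = 1 → n ∣ m)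
    (r : FreeGroup (Fin g ⊕ Fin g) →* Matrix (Fin n) (Fin n) F)
    (hr : r (word g) = algebraMap F _ c) :
    Submodule.span F (Set.range r) = ⊤ := by
  have : NeZero n := ⟨hn⟩
  have hM : Module.finrank F (Matrix (Fin n) (Fin n) F) = n ^ 2 := by
    rw [Module.finrank_matrix, Fintype.card_fin, Module.finrank_self, mul_one, sq]
  have hdim : Module.finrank F (spanAlgebra F r) ≤ n ^ 2 :=
    (Submodule.finrank_le (Subalgebra.toSubmodule (spanAlgebra F r))).trans_eq hM
  obtain ⟨e⟩ := algEquiv_matrix (Λ := spanAlgebra F r) hF hdim hc (toSpanAlgebra r)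
    (Subtype.ext hr)
  rw [← spanAlgebra_toSubmodule]
  apply Submodule.eq_top_of_finrank_eq
  rw [hM, ← hM, ← e.toLinearEquiv.finrank_eq]
  rfl

end Span

/-! ### Stable lattices over valuation rings -/

section Lattice

variable {L : Type*} [Field L] (V : ValuationSubring L) {n : ℕ}

/-- Dividing by a coefficient of largest valuation normalizes a linear relation: all coefficients
become integral and one becomes 1, so the relation survives reduction. -/
theorem ValuationSubring.exists_div_mem {ι : Type*} (s : Finset ι) (a : ι → L) {i₀ : ι}
    (hi₀ : i₀ ∈ s) (h : a i₀ ≠ 0) :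
    ∃ j ∈ s, a j ≠ 0 ∧ V.valuation (a i₀) ≤ V.valuation (a j) ∧ ∀ i ∈ s, a i / a j ∈ V := by
  obtain ⟨j, hj, hmax⟩ := Finset.exists_max_image s (fun i => V.valuation (a i)) ⟨i₀, hi₀⟩
  have hj0 : a j ≠ 0 := by
    intro h0
    have := hmax i₀ hi₀
    rw [h0, map_zero, le_zero_iff, map_eq_zero] at this
    exact h this
  refine ⟨j, hj, hj0, hmax i₀ hi₀, fun i hi => ?_⟩
  rw [← V.valuation_le_one_iff, map_div₀]
  exact div_le_one_of_le₀ (hmax i hi) zero_le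

/-- A matrix `1 - ∑ μᵢ Mᵢ` with `μᵢ` in the maximal ideal is invertible if the coefficients of
`det (1 - ∑ tᵢ Mᵢ)` are integral. -/
theorem det_one_sub_ne_zero {ι : Type*} [Fintype ι] (M : ι → Matrix (Fin n) (Fin n) L)
    (hM : ∀ m, (genDet M).coeff m ∈ V) (μ : ι → V) (hμ : ∀ i, μ i ∈ IsLocalRing.maximalIdeal V) :
    (1 - ∑ i, (μ i : L) • M i).det ≠ 0 := by
  obtain ⟨p, hp⟩ : ∃ p : MvPolynomial ι V, MvPolynomial.map V.subtype p = genDet M := by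
    have : genDet M ∈ Set.range (MvPolynomial.map V.subtype) := by
      rw [MvPolynomial.mem_range_map_iff_coeffs_subset]
      intro a ha
      obtain ⟨m, _, rfl⟩ := MvPolynomial.mem_coeffs_iff.mp ha
      exact ⟨⟨_, hM m⟩, rfl⟩
    exact this
  have he : ∀ t : ι → V, V.subtype (MvPolynomial.eval t p) = (1 - ∑ i, (t i : L) • M i).det := by
    intro t
    have h1 := eval_genDet M (fun i => (t i : L))
    rw [← hp, MvPolynomial.eval_map] at h1
    rw [← h1]
    exact (MvPolynomial.eval₂_comp_left V.subtype (RingHom.id _) t p)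
  have h0 : MvPolynomial.eval (0 : ι → V) p = 1 := by
    apply V.subtype_injective
    rw [he]
    simp
  -- Once its coefficients are in V, the polynomial has the same residue at a point of the maximal
  -- ideal as at 0, where its value is 1.
  have hres : IsLocalRing.residue V (MvPolynomial.eval μ p) =
      IsLocalRing.residue V (MvPolynomial.eval 0 p) := by
    have h2 : ∀ t : ι → V, (∀ i, t i ∈ IsLocalRing.maximalIdeal V) →
        IsLocalRing.residue V (MvPolynomial.eval t p) =
          MvPolynomial.eval₂ (IsLocalRing.residue V) 0 p := by
      intro t ht
      have := MvPolynomial.eval₂_comp_left (IsLocalRing.residue V) (RingHom.id _) t p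
      refine this.trans ?_
      congr 1
      funext i
      exact (IsLocalRing.residue_eq_zero_iff _).mpr (ht i)
    rw [h2 μ hμ, h2 0 fun i => zero_mem _]
  intro hdet
  rw [← he] at hdet
  have : MvPolynomial.eval μ p = 0 := V.subtype_injective (hdet.trans (map_zero _).symm)
  rw [this, h0, map_zero, map_one] at hres
  exact zero_ne_one hres

/-! ### The lattice spanned by an orbit and its reduction. -/

variable {Γ : Type*} [Group Γ] (ρ : Γ →* Matrix (Fin n) (Fin n) L) (v : Fin n → L)

/-- The `V`-submodule generated by the orbit of a vector. -/
def orbitSpan : Submodule V (Fin n → L) := Submodule.span V (Set.range fun γ => ρ γ *ᵥ v)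

theorem mulVec_mem_orbitSpan (γ : Γ) {y : Fin n → L} (hy : y ∈ orbitSpan V ρ v) :
    ρ γ *ᵥ y ∈ orbitSpan V ρ v := by
  have : orbitSpan V ρ v ≤ (orbitSpan V ρ v).comap
      ((Matrix.mulVecLin (ρ γ)).restrictScalars V) := by
    rw [orbitSpan, Submodule.span_le]
    rintro _ ⟨δ, rfl⟩
    apply Submodule.subset_span
    refine ⟨γ * δ, ?_⟩
    simp
  exact this hy

theorem self_mem_orbitSpan : v ∈ orbitSpan V ρ v :=
  Submodule.subset_span ⟨1, by simp⟩

/-- Replaces Nakayama's lemma, since the orbit span is not known to be finitely generated. If v = ∑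
a_γ ρ(γ) v with a_γ in the maximal ideal, then 1 - ∑ a_γ ρ(γ) kills v although its determinant is
nonzero. -/
theorem not_mem_maximalIdeal_smul_orbitSpan (hv : v ≠ 0)
    (hρ : ∀ (s : Finset Γ) (m : s →₀ ℕ), (genDet fun γ : s => ρ γ).coeff m ∈ V) :
    v ∉ IsLocalRing.maximalIdeal V • orbitSpan V ρ v := by
  intro h
  obtain ⟨a, ha, hsum⟩ := (Submodule.mem_ideal_smul_span_iff_exists_sum _ _ _).mp h
  apply det_one_sub_ne_zero V (fun γ : a.support => ρ γ) (hρ _) (fun γ => a γ) (fun γ => ha γ)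
  rw [← Matrix.exists_mulVec_eq_zero_iff]
  refine ⟨v, hv, ?_⟩
  rw [Matrix.sub_mulVec, Matrix.one_mulVec, sub_eq_zero]
  conv_lhs => rw [← hsum]
  rw [Finsupp.sum, ← Finset.sum_coe_sort, Matrix.sum_mulVec]
  refine Finset.sum_congr rfl fun γ _ => ?_
  rw [Matrix.smul_mulVec]
  rfl

/-- The reduction of the module spanned by an orbit. -/
abbrev OrbitReduction : Type _ :=
  orbitSpan V ρ v ⧸ (IsLocalRing.maximalIdeal V • ⊤ : Submodule V (orbitSpan V ρ v))

noncomputable local instance : Field (V ⧸ IsLocalRing.maximalIdeal V) :=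
  Ideal.Quotient.field _

/-- A relation over L, divided by its coefficient of largest valuation, reduces to a nontrivial
relation over the residue field. -/
theorem linearIndependent_of_reduction {ι : Type*} (b : ι → orbitSpan V ρ v)
    (hb : LinearIndependent (V ⧸ IsLocalRing.maximalIdeal V)
      fun i => (Submodule.Quotient.mk (b i) : OrbitReduction V ρ v)) :
    LinearIndependent L fun i => (b i : Fin n → L) := by
  rw [linearIndependent_iff'] at hb ⊢
  intro s a hs i₀ hi₀
  by_contra h0
  obtain ⟨j, hj, hj0, -, hdiv⟩ := ValuationSubring.exists_div_mem V s a hi₀ h0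
  classical
  let a' : ι → V := fun i => if hi : i ∈ s then ⟨a i / a j, hdiv i hi⟩ else 0
  have hsum : ∑ i ∈ s, a' i • b i = 0 := by
    apply Subtype.ext
    have : ∑ i ∈ s, (a i / a j) • (b i : Fin n → L) = 0 := by
      simp only [div_eq_inv_mul, mul_smul, ← Finset.smul_sum, hs, smul_zero]
    rw [Submodule.coe_sum, Submodule.coe_zero, ← this]
    refine Finset.sum_congr rfl fun i hi => ?_
    simp only [a', dif_pos hi]
    rfl
  have h1 := hb s (fun i => Ideal.Quotient.mk _ (a' i)) (by
    have := congrArg (Submodule.mkQ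
      (IsLocalRing.maximalIdeal V • ⊤ : Submodule V (orbitSpan V ρ v))) hsum
    rw [map_sum, map_zero] at this
    exact this) j hj
  have h2 : a' j = 1 := by
    apply Subtype.ext
    simp only [a', dif_pos hj]
    exact div_self hj0
  rw [h2, map_one] at h1
  exact one_ne_zero h1

theorem rank_reduction_le :
    Module.rank (V ⧸ IsLocalRing.maximalIdeal V) (OrbitReduction V ρ v) ≤ n := by
  apply rank_le
  intro s hs
  have := linearIndependent_of_reduction V ρ v (fun i : s => Quotient.out i.1) (by
    convert hs using 1
    funext i
    exact Quotient.out_eq' _)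
  have := this.fintype_card_le_finrank
  simpa using this

/-- The action of a group element on the module spanned by an orbit. -/
def orbitEnd (γ : Γ) : orbitSpan V ρ v →ₗ[V] orbitSpan V ρ v :=
  ((Matrix.mulVecLin (ρ γ)).restrictScalars V).restrict
    fun _ hy => mulVec_mem_orbitSpan V ρ v γ hy

theorem coe_orbitEnd (γ : Γ) (y : orbitSpan V ρ v) :
    (orbitEnd V ρ v γ y : Fin n → L) = ρ γ *ᵥ (y : Fin n → L) := rfl

/-- The action of a group element on the reduction. -/
noncomputable def reductionEnd (γ : Γ) :
    Module.End (V ⧸ IsLocalRing.maximalIdeal V) (OrbitReduction V ρ v) :=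
  LinearMap.extendScalarsOfSurjective (R := V)
    (Ideal.Quotient.mk_surjective (I := IsLocalRing.maximalIdeal V))
    (Submodule.mapQ _ _ (orbitEnd V ρ v γ) (by
        rw [← Submodule.map_le_iff_le_comap, Submodule.map_smul'']
        exact smul_mono_right _ le_top))

theorem reductionEnd_mk (γ : Γ) (y : orbitSpan V ρ v) :
    reductionEnd V ρ v γ (Submodule.Quotient.mk y) =
      Submodule.Quotient.mk (orbitEnd V ρ v γ y) := rfl

/-- The representation of the group on the reduction. -/
noncomputable def reductionRep :
    Γ →* Module.End (V ⧸ IsLocalRing.maximalIdeal V) (OrbitReduction V ρ v) where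
  toFun := reductionEnd V ρ v
  map_one' := by
    refine LinearMap.ext fun y => ?_
    obtain ⟨y, rfl⟩ := Submodule.Quotient.mk_surjective _ y
    rw [reductionEnd_mk, Module.End.one_apply]
    congr 1
    apply Subtype.ext
    rw [coe_orbitEnd, map_one, Matrix.one_mulVec]
  map_mul' γ δ := by
    refine LinearMap.ext fun y => ?_
    obtain ⟨y, rfl⟩ := Submodule.Quotient.mk_surjective _ y
    rw [Module.End.mul_apply, reductionEnd_mk, reductionEnd_mk, reductionEnd_mk]
    congr 1
    apply Subtype.ext
    rw [coe_orbitEnd, coe_orbitEnd, coe_orbitEnd, map_mul, Matrix.mulVec_mulVec]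

theorem nontrivial_orbitReduction (hv : v ≠ 0)
    (hρ : ∀ (s : Finset Γ) (m : s →₀ ℕ), (genDet fun γ : s => ρ γ).coeff m ∈ V) :
    Nontrivial (OrbitReduction V ρ v) := by
  refine Submodule.Quotient.nontrivial_iff.mpr fun h => ?_
  apply not_mem_maximalIdeal_smul_orbitSpan V ρ v hv hρ
  have h1 : (⟨v, self_mem_orbitSpan V ρ v⟩ : orbitSpan V ρ v) ∈
      (IsLocalRing.maximalIdeal V • ⊤ : Submodule V (orbitSpan V ρ v)) := by
    rw [h]
    trivial
  have h2 := Submodule.mem_map_of_mem (f := (orbitSpan V ρ v).subtype) h1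
  rw [Submodule.map_smul'', Submodule.map_top, Submodule.range_subtype] at h2
  exact h2

/-- The word acts on the reduction as c and with determinant 1, so n divides the dimension, which is
positive and at most n. -/
theorem finrank_orbitReduction {g : ℕ} (ρ : FreeGroup (Fin g ⊕ Fin g) →* Matrix (Fin n) (Fin n) L)
    {c : V} (hc : ∀ m : ℕ, Ideal.Quotient.mk (IsLocalRing.maximalIdeal V) c ^ m = 1 → n ∣ m)
    (hw : ρ (word g) = Matrix.scalar (Fin n) (c : L)) (hv : v ≠ 0)
    (hρ : ∀ (s : Finset (FreeGroup (Fin g ⊕ Fin g))) (m : s →₀ ℕ),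
      (genDet fun γ : s => ρ γ).coeff m ∈ V) :
    Module.finrank (V ⧸ IsLocalRing.maximalIdeal V) (OrbitReduction V ρ v) = n := by
  have hrank := rank_reduction_le V ρ v
  have : Module.Finite (V ⧸ IsLocalRing.maximalIdeal V) (OrbitReduction V ρ v) :=
    Module.rank_lt_aleph0_iff.mp (hrank.trans_lt (Cardinal.natCast_lt_aleph0))
  have := nontrivial_orbitReduction V ρ v hv hρ
  refine le_antisymm (Module.finrank_le_of_rank_le hrank) (Nat.le_of_dvd Module.finrank_pos ?_)
  apply hc
  have h1 := map_surfaceWord_eq_one (LinearMap.det.comp (reductionRep V ρ v)) FreeGroup.of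
  have h2 : reductionRep V ρ v (word g) =
      Ideal.Quotient.mk (IsLocalRing.maximalIdeal V) c • (1 : Module.End _ _) := by
    refine LinearMap.ext fun y => ?_
    obtain ⟨y, rfl⟩ := Submodule.Quotient.mk_surjective _ y
    have h3 : orbitEnd V ρ v (word g) y = c • y := by
      apply Subtype.ext
      rw [coe_orbitEnd, hw]
      change (Matrix.scalar (Fin n) (c : L)) *ᵥ _ = (c : L) • _
      rw [Matrix.scalar_apply, ← Matrix.smul_one_eq_diagonal, Matrix.smul_mulVec,
        Matrix.one_mulVec]
    change reductionEnd V ρ v (word g) _ = _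
    rw [reductionEnd_mk, h3]
    rfl
  change LinearMap.det (reductionRep V ρ v (word g)) = 1 at h1
  rwa [h2, LinearMap.det_smul, map_one, mul_one] at h1

/-- A representation over the fraction field of a valuation ring that satisfies the twisted surface
relation and has integral characteristic polynomials preserves a lattice. -/
theorem exists_conj_integral {g : ℕ} (hn : n ≠ 0)
    (ρ : FreeGroup (Fin g ⊕ Fin g) →* Matrix (Fin n) (Fin n) L)
    {c : V} (hc : ∀ m : ℕ, Ideal.Quotient.mk (IsLocalRing.maximalIdeal V) c ^ m = 1 → n ∣ m)
    (hw : ρ (word g) = Matrix.scalar (Fin n) (c : L))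
    (hρ : ∀ (s : Finset (FreeGroup (Fin g ⊕ Fin g))) (m : s →₀ ℕ),
      (genDet fun γ : s => ρ γ).coeff m ∈ V) :
    ∃ P Q : Matrix (Fin n) (Fin n) L, P * Q = 1 ∧ ∀ γ i j, (P * ρ γ * Q) i j ∈ V := by
  -- Any nonzero vector would do.
  let v : Fin n → L := fun _ => 1
  have hv : v ≠ 0 := fun h => one_ne_zero (congrFun h ⟨0, Nat.pos_of_ne_zero hn⟩)
  have hfin := finrank_orbitReduction V v ρ hc hw hv hρ
  have : Module.Finite (V ⧸ IsLocalRing.maximalIdeal V) (OrbitReduction V ρ v) :=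
    Module.finite_of_finrank_pos (by omega)
  let B := Module.finBasisOfFinrankEq _ _ hfin
  choose b hb using fun i => Submodule.Quotient.mk_surjective _ (B i)
  have hBi : LinearIndependent (V ⧸ IsLocalRing.maximalIdeal V)
      fun i => (Submodule.Quotient.mk (b i) : OrbitReduction V ρ v) := by
    simp only [hb]
    exact B.linearIndependent
  have hli := linearIndependent_of_reduction V ρ v b hBi
  let H : Matrix (Fin n) (Fin n) L := Matrix.of fun i j => (b j : Fin n → L) i
  have hH : IsUnit H := by
    rw [← Matrix.linearIndependent_cols_iff_isUnit]
    exact hli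
  have hdet : IsUnit H.det := (Matrix.isUnit_iff_isUnit_det H).mp hH
  have hcol : ∀ a : Fin n → L, H *ᵥ a = ∑ i, a i • (b i : Fin n → L) := by
    intro a
    ext k
    simp [Matrix.mulVec, dotProduct, H, mul_comm]
  -- The lifted basis generates the whole orbit span over V. If y had a non-integral coordinate, let
  -- μ be the inverse of its largest one. Then μ lies in the maximal ideal, so μ y reduces to 0,
  -- while its coordinates are integral and one of them is 1: this contradicts independence of the
  -- reduced basis.
  have key : ∀ y ∈ orbitSpan V ρ v, ∀ i, (H⁻¹ *ᵥ y) i ∈ V := by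
    intro y hy i₀
    set a := H⁻¹ *ᵥ y with ha
    have hya : y = ∑ i, a i • (b i : Fin n → L) := by
      rw [← hcol, ha, Matrix.mulVec_mulVec, Matrix.mul_nonsing_inv _ hdet, Matrix.one_mulVec]
    by_contra hi₀
    have h0 : a i₀ ≠ 0 := fun h => hi₀ (h ▸ zero_mem V)
    obtain ⟨j, -, hj0, hle, hdiv⟩ :=
      ValuationSubring.exists_div_mem V Finset.univ a (Finset.mem_univ i₀) h0
    have hlt : 1 < V.valuation (a j) := by
      refine lt_of_lt_of_le ?_ hle
      rw [← not_le, V.valuation_le_one_iff]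
      exact hi₀
    have hinv : V.valuation (a j)⁻¹ < 1 := by
      rw [map_inv₀]
      exact inv_lt_one_of_one_lt₀ hlt
    let μ : V := ⟨(a j)⁻¹, (V.valuation_le_one_iff _).mp hinv.le⟩
    have hμ : μ ∈ IsLocalRing.maximalIdeal V := (V.valuation_lt_one_iff μ).mpr hinv
    let a' : Fin n → V := fun i => ⟨a i / a j, hdiv i (Finset.mem_univ i)⟩
    have hsum : μ • (⟨y, hy⟩ : orbitSpan V ρ v) = ∑ i, a' i • b i := by
      apply Subtype.ext
      rw [Submodule.coe_sum]
      change (a j)⁻¹ • y = ∑ i, (a i / a j) • (b i : Fin n → L)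
      rw [hya, Finset.smul_sum]
      simp only [smul_smul, div_eq_inv_mul]
    have h1 := (Fintype.linearIndependent_iff.mp hBi)
      (fun i => Ideal.Quotient.mk _ (a' i)) (by
        have h2 := congrArg (Submodule.mkQ
          (IsLocalRing.maximalIdeal V • ⊤ : Submodule V (orbitSpan V ρ v))) hsum
        rw [map_sum] at h2
        refine Eq.trans ?_ (h2.symm.trans ?_)
        · rfl
        · exact (Submodule.Quotient.mk_eq_zero _).mpr (Submodule.smul_mem_smul hμ trivial)) j
    have h2 : a' j = 1 := Subtype.ext (div_self hj0)
    rw [h2, map_one] at h1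
    exact one_ne_zero h1
  refine ⟨H⁻¹, H, Matrix.nonsing_inv_mul _ hdet, fun γ i j => ?_⟩
  have h3 : (H⁻¹ * ρ γ * H) i j = (H⁻¹ *ᵥ (ρ γ *ᵥ (b j : Fin n → L))) i := by
    rw [Matrix.mulVec_mulVec]
    rfl
  rw [h3]
  exact key _ (mulVec_mem_orbitSpan V ρ v γ (b j).2) i

end Lattice

/-! ### Lifting rational points of the quotient to points over a field -/

/-- The kernel of φ need not be contracted from A, but a minimal prime of S below it is, because i
is injective. Passing to the fraction field of A modulo such a prime keeps the image of ker φ a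
proper ideal, and a valuation ring dominates it. -/
theorem exists_valuationSubring_dominating {S A K : Type u} [CommRing S] [CommRing A] [Field K]
    (i : S →+* A) (hi : Function.Injective i) (φ : S →+* K) :
    ∃ (L : Type u) (_ : Field L) (ψ : A →+* L) (V : ValuationSubring L),
      (∀ s, ψ (i s) ∈ V) ∧ ∀ s, φ s = 0 → ψ (i s) ∈ V.nonunits := by
  have : (RingHom.ker φ).IsPrime := RingHom.ker_isPrime φ
  obtain ⟨p, hp, hpφ⟩ := Ideal.exists_minimalPrimes_le (I := ⊥) (J := RingHom.ker φ) bot_le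
  obtain ⟨P, hP, hPp⟩ := Ideal.exists_comap_eq_of_mem_minimalPrimes_of_injective hi p hp
  let L := FractionRing (A ⧸ P)
  let ψ : A →+* L := (algebraMap (A ⧸ P) L).comp (Ideal.Quotient.mk P)
  let T : Subring L := (ψ.comp i).range
  let τ : S →+* T := (ψ.comp i).rangeRestrict
  have hker : ∀ s, τ s = 0 → φ s = 0 := by
    intro s hs
    have h1 : ψ (i s) = 0 := congrArg Subtype.val hs
    have h2 : Ideal.Quotient.mk P (i s) = 0 :=
      IsFractionRing.injective (A ⧸ P) L (h1.trans (map_zero _).symm)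
    have h3 : s ∈ P.comap i := Ideal.mem_comap.mpr (Ideal.Quotient.eq_zero_iff_mem.mp h2)
    rw [hPp] at h3
    exact hpφ h3
  -- The kernel of S → T lies in ker φ, so 1 cannot be the image of an element of ker φ.
  have hI : (RingHom.ker φ).map τ ≠ ⊤ := by
    rw [Ne, Ideal.eq_top_iff_one]
    intro h
    obtain ⟨s, hs, h1⟩ :=
      (Ideal.mem_map_iff_of_surjective τ (ψ.comp i).rangeRestrict_surjective).mp h
    have h2 := hker (s - 1) (by rw [map_sub, h1, map_one, sub_self])
    rw [map_sub, map_one, (RingHom.mem_ker).mp hs, zero_sub, neg_eq_zero] at h2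
    exact one_ne_zero h2
  obtain ⟨V, hTV, hV⟩ := Ideal.image_subset_nonunits_valuationSubring _ hI
  exact ⟨L, inferInstance, ψ, V, fun s => hTV ⟨s, rfl⟩,
    fun s hs => hV ⟨τ s, Ideal.mem_map_of_mem τ hs, rfl⟩⟩

section Existence

variable {K : Type u} [Field K] {G : LinGroup} {n g : ℕ} {c : K}

/-- The conjugator lies only in `GL(n, L)`, which is harmless because invariants are unchanged by it
(`eval_eq_of_conj`). -/
theorem exists_integral_point {L : Type u} [Field L] [Algebra K L] (V : ValuationSubring L)
    [Algebra K V] [IsScalarTower K V L] (hn : n ≠ 0) (hc : ∀ m : ℕ, c ^ m = 1 → n ∣ m)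
    (x : TwistedRep G n g c L) (hx : ∀ f ∈ invariants G n g c, eval x f ∈ V) :
    ∃ y : TwistedRep G n g c V, ∀ f ∈ invariants G n g c, (eval y f : L) = eval x f := by
  let ι : V →ₐ[K] L := IsScalarTower.toAlgHom K V L
  have hι : Function.Injective ι := V.subtype_injective
  have hcV : ((algebraMap K V c : V) : L) = algebraMap K L c :=
    (IsScalarTower.algebraMap_apply K V L c).symm
  obtain ⟨P, Q, hPQ, hint⟩ := exists_conj_integral V hn x.rep (c := algebraMap K V c)
    (fun m h => hc m (by
      rw [← map_pow, ← map_pow] at h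
      exact ((Ideal.Quotient.mk (IsLocalRing.maximalIdeal V)).comp (algebraMap K V)).injective
        (h.trans (map_one _).symm)))
    (by rw [x.rep_word, hcV])
    (fun s m => by
      rw [← eval_coeff_genDet]
      exact hx _ (coeff_genDet_mem_invariants _ _))
  have hQP := mul_eq_one_comm.mp hPQ
  let toL : Matrix (Fin n) (Fin n) V →ₐ[K] Matrix (Fin n) (Fin n) L := ι.mapMatrix
  have htoL : Function.Injective toL := Matrix.map_injective hι
  let rfun : FreeGroup (Fin g ⊕ Fin g) → Matrix (Fin n) (Fin n) V :=
    fun γ => Matrix.of fun i j => ⟨(P * x.rep γ * Q) i j, hint γ i j⟩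
  have hr : ∀ γ, toL (rfun γ) = P * x.rep γ * Q := fun γ => rfl
  let r : FreeGroup (Fin g ⊕ Fin g) →* Matrix (Fin n) (Fin n) V :=
    { toFun := rfun
      map_one' := htoL (by rw [hr, map_one, map_one, mul_one, hPQ])
      map_mul' := fun γ δ => htoL (by
        rw [map_mul, hr, hr, hr, map_mul]
        calc P * (x.rep γ * x.rep δ) * Q = P * x.rep γ * (1 * x.rep δ) * Q := by
              simp only [one_mul, mul_assoc]
          _ = _ := by rw [← hQP]; simp only [mul_assoc]) }
  have hr' : ∀ γ, toL (r γ) = P * x.rep γ * Q := hr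
  let y : TwistedRep G n g c V := ofRep r
    (fun hG s => hι (by
      rw [AlgHom.map_det]
      change (toL (r _)).det = _
      rw [hr', det_mul_right_comm, hPQ, one_mul, x.det_rep_of hG, map_one]))
    (htoL (by
      rw [hr', x.rep_word, ← (Matrix.scalar_commute _ (fun _ => Commute.all _ _) _).eq, mul_assoc,
        hPQ, mul_one]
      exact (mapMatrix_scalar ι c).symm))
  refine ⟨y, fun f hf => ?_⟩
  have h1 := eval_eq_of_conj hn x (y.map ι) P Q hPQ (fun s => by
    rw [rep_map, rep_ofRep]
    exact hr' _) f hf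
  rw [eval_map] at h1
  exact h1

/-- Every rational point of the quotient is the image of a point over some algebraically closed
field. -/
theorem exists_point_over_field (hn : n ≠ 0) (hc : ∀ m : ℕ, c ^ m = 1 → n ∣ m)
    (φ : CharacterVarietyPoints G n g c) :
    ∃ (F : Type u) (_ : Field F) (_ : Algebra K F) (_ : IsAlgClosed F) (x : TwistedRep G n g c F),
      ∀ f : invariants G n g c, eval x f = algebraMap K F (φ f) := by
  obtain ⟨L, _, ψ, V, hV, hVφ⟩ := exists_valuationSubring_dominating
    (invariants G n g c).val.toRingHom Subtype.val_injective φ.toRingHom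
  let _ : Algebra K L := (ψ.comp (algebraMap K _)).toAlgebra
  have hKV : ∀ a : K, algebraMap K L a ∈ V := fun a => hV (algebraMap K _ a)
  let _ : Algebra K V := ((algebraMap K L).codRestrict V hKV).toAlgebra
  have : IsScalarTower K V L := IsScalarTower.of_algebraMap_eq fun _ => rfl
  let ψ' : CoordRing n g G c →ₐ[K] L := { ψ with commutes' := fun _ => rfl }
  obtain ⟨y, hy⟩ := exists_integral_point V hn hc ((universal G n g c).map ψ') (fun f hf => by
    rw [eval_map_universal]
    exact hV ⟨f, hf⟩)
  let k := V ⧸ IsLocalRing.maximalIdeal V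
  let _ : Field k := Ideal.Quotient.field _
  let E := AlgebraicClosure k
  let π : V →ₐ[K] k := Ideal.Quotient.mkₐ K _
  let ε : k →ₐ[K] E := IsScalarTower.toAlgHom K k E
  refine ⟨E, inferInstance, inferInstance, inferInstance, y.map (ε.comp π), fun f => ?_⟩
  -- f - φ(f) lies in ker φ, so V's maximal ideal contains its value at y. Hence f takes the value
  -- φ(f) at the reduced point.
  have h0 : φ (f - algebraMap K _ (φ f)) = 0 := by
    rw [map_sub, AlgHom.commutes]
    exact sub_self _
  have h1 := hVφ _ h0
  have h2 : eval y (f - algebraMap K (invariants G n g c) (φ f) : invariants G n g c) ∈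
      IsLocalRing.maximalIdeal V := by
    have h3 := hy _ (f - algebraMap K (invariants G n g c) (φ f) : invariants G n g c).2
    rw [eval_map_universal] at h3
    rw [V.valuation_lt_one_iff, h3]
    exact V.mem_nonunits_iff.mp h1
  have h4 : π (eval y (f - algebraMap K (invariants G n g c) (φ f) : invariants G n g c)) = 0 :=
    Ideal.Quotient.eq_zero_iff_mem.mpr h2
  rw [eval_map, AlgHom.comp_apply, AlgHom.comp_apply]
  have h5 : π (eval y f) = algebraMap K k (φ f) := by
    rw [← sub_eq_zero, ← h4, AddSubgroupClass.coe_sub, map_sub, map_sub,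
      Subalgebra.coe_algebraMap, AlgHom.commutes, AlgHom.commutes]
  rw [h5, AlgHom.commutes]

end Existence

/-! ### Matrix algebras: inner automorphisms and traces -/

section SkolemNoether

variable {F : Type*} [Field F] {n : ℕ}

/-- A matrix algebra is simple, so θ is injective, and bijective by dimension. Automorphisms of the
endomorphism algebra of a vector space are inner. -/
theorem exists_conj_of_algHom (hn : n ≠ 0)
    (θ : Matrix (Fin n) (Fin n) F →ₐ[F] Matrix (Fin n) (Fin n) F) :
    ∃ P Q : Matrix (Fin n) (Fin n) F, P * Q = 1 ∧ ∀ A, θ A = P * A * Q := by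
  have : NeZero n := ⟨hn⟩
  have hinj : Function.Injective θ := θ.toRingHom.injective
  have hbij : Function.Bijective θ :=
    ⟨hinj, (LinearMap.injective_iff_surjective (f := θ.toLinearMap)).mp hinj⟩
  let e : Matrix (Fin n) (Fin n) F ≃ₐ[F] Module.End F (Fin n → F) := Matrix.toLinAlgEquiv'
  obtain ⟨T, hT⟩ :=
    AlgEquiv.eq_linearEquivConjAlgEquiv (e.symm.trans ((AlgEquiv.ofBijective θ hbij).trans e))
  refine ⟨e.symm T.toLinearMap, e.symm T.symm.toLinearMap, ?_, fun A => e.injective ?_⟩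
  · rw [← map_mul, Module.End.mul_eq_comp, LinearEquiv.comp_symm]
    exact map_one _
  · rw [map_mul, map_mul, AlgEquiv.apply_symm_apply, AlgEquiv.apply_symm_apply]
    have := DFunLike.congr_fun hT (e A)
    rw [AlgEquiv.trans_apply, AlgEquiv.symm_apply_apply] at this
    exact this

/-- Skolem–Noether for embeddings of a matrix algebra into its scalar extension. -/
theorem exists_conj_of_algHom_baseChange {K : Type*} [Field K] [Algebra K F] (hn : n ≠ 0)
    (θ : Matrix (Fin n) (Fin n) K →ₐ[K] Matrix (Fin n) (Fin n) F) :
    ∃ P Q : Matrix (Fin n) (Fin n) F, P * Q = 1 ∧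
      ∀ A, θ A = P * A.map (algebraMap K F) * Q := by
  let τ : TensorProduct K F (Matrix (Fin n) (Fin n) K) →ₐ[F] Matrix (Fin n) (Fin n) F :=
    Algebra.TensorProduct.lift (Algebra.ofId F _) θ fun a _ => Algebra.commutes a _
  have hτ : ∀ a A, τ (TensorProduct.tmul K a A) = algebraMap F _ a * θ A :=
    fun a A => Algebra.TensorProduct.lift_tmul _ _ _ a A
  have h : ∀ (a : F) (A : Matrix (Fin n) (Fin n) K),
      matrixEquivTensor (Fin n) K F (a • A.map (algebraMap K F)) = TensorProduct.tmul K a A := by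
    intro a A
    rw [← matrixEquivTensor_apply_symm, AlgEquiv.apply_symm_apply]
  -- The F-linear extension of θ along F ⊗ M_n(K) ≃ M_n(F).
  let θ' : Matrix (Fin n) (Fin n) F →ₐ[F] Matrix (Fin n) (Fin n) F :=
    { (τ.restrictScalars K).comp (matrixEquivTensor (Fin n) K F).toAlgHom with
      commutes' := fun a => by
        change τ (matrixEquivTensor (Fin n) K F (algebraMap F _ a)) = _
        have h1 : algebraMap F (Matrix (Fin n) (Fin n) F) a =
            a • (1 : Matrix (Fin n) (Fin n) K).map (algebraMap K F) := by
          rw [Matrix.map_one _ (map_zero _) (map_one _), Algebra.algebraMap_eq_smul_one]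
        rw [h1, h, hτ, map_one, mul_one, ← h1] }
  have hθ' : ∀ A, θ' (A.map (algebraMap K F)) = θ A := by
    intro A
    change τ (matrixEquivTensor (Fin n) K F (A.map (algebraMap K F))) = _
    rw [← one_smul F (A.map (algebraMap K F)), h, hτ, map_one, one_mul]
  obtain ⟨P, Q, hPQ, hP⟩ := exists_conj_of_algHom hn θ'
  exact ⟨P, Q, hPQ, fun A => by rw [← hθ', hP]⟩

theorem eq_zero_of_trace_mul_eq_zero {s : Set (Matrix (Fin n) (Fin n) F)}
    (hs : Submodule.span F s = ⊤) {A : Matrix (Fin n) (Fin n) F}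
    (h : ∀ B ∈ s, (A * B).trace = 0) : A = 0 := by
  rw [Matrix.ext_iff_trace_mul_right]
  intro B
  rw [zero_mul, trace_zero]
  have : Submodule.span F s ≤
      LinearMap.ker ((traceLinearMap (Fin n) F F).comp (LinearMap.mulLeft F A)) :=
    Submodule.span_le.mpr h
  exact this (hs ▸ Submodule.mem_top)

/-- Absolutely irreducible representations with equal traces are conjugate. -/
theorem exists_conj_of_trace_eq {Γ : Type*} [Group Γ] (hn : n ≠ 0)
    {r r' : Γ →* Matrix (Fin n) (Fin n) F} (hr : Submodule.span F (Set.range r) = ⊤)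
    (hr' : Submodule.span F (Set.range r') = ⊤) (h : ∀ γ, (r γ).trace = (r' γ).trace) :
    ∃ P Q : Matrix (Fin n) (Fin n) F, P * Q = 1 ∧ ∀ γ, r' γ = P * r γ * Q := by
  let l := MonoidAlgebra.lift F (Matrix (Fin n) (Fin n) F) Γ r
  let l' := MonoidAlgebra.lift F (Matrix (Fin n) (Fin n) F) Γ r'
  have hl : ∀ γ, l (MonoidAlgebra.of F Γ γ) = r γ := MonoidAlgebra.lift_of r
  have hl' : ∀ γ, l' (MonoidAlgebra.of F Γ γ) = r' γ := MonoidAlgebra.lift_of r'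
  have htr : ∀ a, (l a).trace = (l' a).trace := by
    intro a
    induction a using MonoidAlgebra.induction_on with
    | of γ => rw [hl, hl', h]
    | add a b ha hb => rw [map_add, map_add, trace_add, trace_add, ha, hb]
    | smul t a ha => rw [map_smul, map_smul, trace_smul, trace_smul, ha]
  -- The trace form against the spanning values of r' detects zero and can be computed through r. So
  -- r(γ) ↦ r'(γ) extends to an endomorphism of the matrix algebra.
  have hker : ∀ a, l a = 0 → l' a = 0 := by
    intro a ha
    apply eq_zero_of_trace_mul_eq_zero hr'
    rintro _ ⟨γ, rfl⟩
    rw [← hl', ← map_mul, ← htr, map_mul, ha, zero_mul, trace_zero]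
  have heq : ∀ a b, l a = l b → l' a = l' b := by
    intro a b hab
    rw [← sub_eq_zero, ← map_sub]
    exact hker _ (by rw [map_sub, hab, sub_self])
  have hsurj : Function.Surjective l := by
    have : Submodule.span F (Set.range r) ≤ LinearMap.range l.toLinearMap := by
      rw [Submodule.span_le]
      rintro _ ⟨γ, rfl⟩
      exact ⟨_, hl γ⟩
    intro A
    exact this (hr ▸ Submodule.mem_top)
  choose σ hσ using hsurj
  let θ : Matrix (Fin n) (Fin n) F →ₐ[F] Matrix (Fin n) (Fin n) F :=
    { toFun := fun A => l' (σ A)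
      map_one' := by rw [heq (σ 1) 1 (by rw [hσ, map_one]), map_one]
      map_zero' := by rw [heq (σ 0) 0 (by rw [hσ, map_zero]), map_zero]
      map_mul' := fun A B => by rw [← map_mul]; exact heq _ _ (by rw [map_mul, hσ, hσ, hσ])
      map_add' := fun A B => by rw [← map_add]; exact heq _ _ (by rw [map_add, hσ, hσ, hσ])
      commutes' := fun a => by
        rw [heq _ (algebraMap F _ a) (by rw [hσ, AlgHom.commutes]), AlgHom.commutes] }
  obtain ⟨P, Q, hPQ, hP⟩ := exists_conj_of_algHom hn θ
  refine ⟨P, Q, hPQ, fun γ => ?_⟩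
  rw [← hP, ← hl', ← hl]
  exact heq _ _ (hσ _).symm

theorem exists_eq_smul_one_of_commute {Γ : Type*} [Group Γ]
    {r : Γ →* Matrix (Fin n) (Fin n) F} (hr : Submodule.span F (Set.range r) = ⊤)
    {P : Matrix (Fin n) (Fin n) F} (h : ∀ γ, P * r γ = r γ * P) : ∃ a : F, P = a • 1 := by
  have hall : ∀ A, P * A = A * P := by
    intro A
    have : Submodule.span F (Set.range r) ≤
        LinearMap.ker (LinearMap.mulLeft F P - LinearMap.mulRight F P) := by
      rw [Submodule.span_le]
      rintro _ ⟨γ, rfl⟩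
      exact sub_eq_zero.mpr (h γ)
    exact sub_eq_zero.mp (this (hr ▸ Submodule.mem_top : A ∈ _))
  obtain ⟨a, ha⟩ := Matrix.mem_range_scalar_of_commute_single (M := P)
    fun i j _ => (hall (Matrix.single i j 1)).symm
  refine ⟨a, ?_⟩
  rw [← ha, Matrix.scalar_apply, Matrix.smul_one_eq_diagonal]

/-- Choose an F-basis of matrices among the values of r. Pairing with it under the trace form is
injective and sends the K-span into K^(n²), since products of values are again values. -/
theorem finite_finrank_spanAlgebra_le {K : Type*} [Field K] [Algebra K F] {Γ : Type*} [Group Γ]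
    {r : Γ →* Matrix (Fin n) (Fin n) F} (hr : Submodule.span F (Set.range r) = ⊤)
    (htr : ∀ γ, (r γ).trace ∈ (algebraMap K F).range) :
    Module.Finite K (spanAlgebra K r) ∧ Module.finrank K (spanAlgebra K r) ≤ n ^ 2 := by
  have hM : Module.finrank F (Matrix (Fin n) (Fin n) F) = n ^ 2 := by
    rw [Module.finrank_matrix, Fintype.card_fin, Module.finrank_self, mul_one, sq]
  obtain ⟨b, hb, hspan, -⟩ := Submodule.exists_fun_fin_finrank_span_eq F (Set.range r)
  have hcard : Module.finrank F (Submodule.span F (Set.range r)) = n ^ 2 := by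
    rw [hr, finrank_top, hM]
  replace hspan := hspan.trans hr
  let T : Matrix (Fin n) (Fin n) F →ₗ[K]
      (Fin (Module.finrank F (Submodule.span F (Set.range r))) → F) :=
    LinearMap.pi fun i =>
      ((traceLinearMap (Fin n) F F).comp (LinearMap.mulRight F (b i))).restrictScalars K
  have hT : ∀ A i, T A i = (A * b i).trace := fun _ _ => rfl
  have hTinj : Function.Injective T := by
    rw [← LinearMap.ker_eq_bot, LinearMap.ker_eq_bot']
    intro A hA
    apply eq_zero_of_trace_mul_eq_zero hspan
    rintro _ ⟨i, rfl⟩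
    rw [← hT, hA]
    rfl
  let J : (Fin (Module.finrank F (Submodule.span F (Set.range r))) → K) →ₗ[K]
      (Fin (Module.finrank F (Submodule.span F (Set.range r))) → F) :=
    LinearMap.pi fun i => (Algebra.linearMap K F).comp (LinearMap.proj i)
  have hmap : (Subalgebra.toSubmodule (spanAlgebra K r)).map T ≤ LinearMap.range J := by
    rw [spanAlgebra_toSubmodule, Submodule.map_span, Submodule.span_le]
    rintro _ ⟨_, ⟨γ, rfl⟩, rfl⟩
    have : ∀ i, ∃ a : K, algebraMap K F a = T (r γ) i := by
      intro i
      obtain ⟨δ, hδ⟩ := hb i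
      rw [hT, ← hδ, ← map_mul]
      exact htr _
    choose a ha using this
    exact ⟨a, funext ha⟩
  let E := Subalgebra.toSubmodule (spanAlgebra K r)
  have hfin : Module.Finite K (E.map T) :=
    Submodule.finiteDimensional_of_le hmap
  let eq := Submodule.equivMapOfInjective T hTinj E
  have : Module.Finite K E := Module.Finite.equiv eq.symm
  refine ⟨this, ?_⟩
  calc Module.finrank K E = Module.finrank K (E.map T) := eq.finrank_eq
    _ ≤ Module.finrank K (LinearMap.range J) := Submodule.finrank_mono hmap
    _ ≤ _ := LinearMap.finrank_range_le J
    _ = n ^ 2 := by rw [Module.finrank_fin_fun, hcard]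

end SkolemNoether

/-! ### Rational points of the quotient and rational twisted representations -/

section Descent

variable {K : Type u} [Field K] {G : LinGroup} {n g : ℕ} {c : K}

theorem span_range_rep_eq_top {F : Type v} [Field F] [Algebra K F] (hF : IsAlgClosed F ∨ Finite F)
    (hn : n ≠ 0) (hc : ∀ m : ℕ, c ^ m = 1 → n ∣ m) (x : TwistedRep G n g c F) :
    Submodule.span F (Set.range x.rep) = ⊤ := by
  refine span_range_eq_top hF hn (c := algebraMap K F c) (fun m h => hc m ?_) x.rep ?_
  · rw [← map_pow] at h
    exact (algebraMap K F).injective (h.trans (map_one _).symm)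
  · rw [rep_word, Matrix.algebraMap_eq_diagonal, Matrix.scalar_apply]
    rfl

variable [Finite K]

/-- Every rational point of the quotient is the image of a rational twisted representation. -/
theorem exists_rational_point (hn : n ≠ 0) (hc : ∀ m : ℕ, c ^ m = 1 → n ∣ m)
    (φ : CharacterVarietyPoints G n g c) :
    ∃ y : TwistedRep G n g c K, (eval y).comp (invariants G n g c).val = φ := by
  obtain ⟨F, _, _, hF, x, hx⟩ := exists_point_over_field hn hc φ
  have : NeZero n := ⟨hn⟩
  have hspan := span_range_rep_eq_top (Or.inl hF) hn hc x
  obtain ⟨hfin, hdim⟩ := finite_finrank_spanAlgebra_le (K := K) hspan fun γ =>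
    ⟨_, ((hx ⟨_, trace_mem_invariants γ⟩).symm.trans (eval_trace x γ))⟩
  have hinj := (algebraMap K F).injective
  -- The K-form of the matrix algebra spanned by x is split because K is finite.
  obtain ⟨e⟩ := algEquiv_matrix (Or.inr ‹_›) hdim hc (toSpanAlgebra x.rep) (Subtype.ext (by
    change x.rep _ = _
    rw [rep_word]
    change _ = algebraMap K (Matrix (Fin n) (Fin n) F) c
    rw [Matrix.algebraMap_eq_diagonal, Matrix.scalar_apply]
    rfl))
  obtain ⟨P, Q, hPQ, hP⟩ := exists_conj_of_algHom_baseChange hn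
    ((spanAlgebra K x.rep).val.comp (e.symm : Matrix (Fin n) (Fin n) K →ₐ[K] _))
  let r : FreeGroup (Fin g ⊕ Fin g) →* Matrix (Fin n) (Fin n) K :=
    (e : spanAlgebra K x.rep →* Matrix (Fin n) (Fin n) K).comp (toSpanAlgebra x.rep)
  have hr : ∀ γ, x.rep γ = P * (r γ).map (algebraMap K F) * Q := by
    intro γ
    rw [← hP]
    change _ = (e.symm (e (toSpanAlgebra x.rep γ))).val
    rw [AlgEquiv.symm_apply_apply]
    rfl
  let y : TwistedRep G n g c K := ofRep r
    (fun hG s => hinj (by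
      have := congrArg det (hr (FreeGroup.of s))
      rw [x.det_rep_of hG, det_mul_right_comm, hPQ, one_mul] at this
      rw [map_one, this, RingHom.map_det]
      rfl))
    (by
      change e (toSpanAlgebra x.rep (word g)) = _
      have : toSpanAlgebra x.rep (word g) = algebraMap K (spanAlgebra K x.rep) c :=
        Subtype.ext (by
          change x.rep _ = algebraMap K (Matrix (Fin n) (Fin n) F) c
          rw [rep_word, Matrix.algebraMap_eq_diagonal, Matrix.scalar_apply]
          rfl)
      rw [this, AlgEquiv.commutes, Matrix.algebraMap_eq_diagonal, Matrix.scalar_apply]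
      rfl)
  refine ⟨y, AlgHom.ext fun f => hinj ?_⟩
  have h1 := eval_eq_of_conj hn (y.map (Algebra.ofId K F)) x P Q hPQ (fun s => by
    rw [rep_map, rep_ofRep]
    exact hr _) f f.2
  rw [eval_map, hx] at h1
  exact h1.symm

/-- Rational twisted representations with the same image in the quotient are conjugate under
`GL(n)`. -/
theorem exists_conj_of_eval_eq (hn : n ≠ 0) (hc : ∀ m : ℕ, c ^ m = 1 → n ∣ m)
    {x y : TwistedRep G n g c K}
    (h : (eval x).comp (invariants G n g c).val = (eval y).comp (invariants G n g c).val) :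
    ∃ P Q : Matrix (Fin n) (Fin n) K, P * Q = 1 ∧ ∀ γ, y.rep γ = P * x.rep γ * Q := by
  refine exists_conj_of_trace_eq hn (span_range_rep_eq_top (Or.inr ‹_›) hn hc x)
    (span_range_rep_eq_top (Or.inr ‹_›) hn hc y) fun γ => ?_
  rw [← eval_trace x, ← eval_trace y]
  exact DFunLike.congr_fun h ⟨_, trace_mem_invariants γ⟩

end Descent

/-! ### Counting rational points -/

section Count

variable {K : Type u} [Field K] {G : LinGroup} {n g : ℕ} {c : K}

/-- Simultaneous conjugation by an element of `GL(n)`. -/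
def glConj (h : GeneralLinearGroup (Fin n) K) (x : TwistedRep G n g c K) : TwistedRep G n g c K :=
  ofRep
    { toFun := fun γ => h.val * x.rep γ * h⁻¹.val
      map_one' := by rw [map_one, mul_one, Units.mul_inv]
      map_mul' := fun γ δ => by
        rw [map_mul]
        simp only [mul_assoc, Units.inv_mul_cancel_left] }
    (fun hG s => by
      change (h.val * x.rep _ * h⁻¹.val).det = 1
      rw [det_mul_right_comm, Units.mul_inv, one_mul, x.det_rep_of hG])
    (by
      change h.val * x.rep _ * h⁻¹.val = _
      rw [x.rep_word, ← (Matrix.scalar_commute _ (fun _ => Commute.all _ _) _).eq, mul_assoc,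
        Units.mul_inv, mul_one])

theorem rep_glConj (h : GeneralLinearGroup (Fin n) K) (x : TwistedRep G n g c K)
    (γ : FreeGroup (Fin g ⊕ Fin g)) : (glConj h x).rep γ = h.val * x.rep γ * h⁻¹.val := by
  rw [glConj, rep_ofRep]
  rfl

/-- The image of a rational twisted representation in the quotient. -/
noncomputable def toQuotient (x : TwistedRep G n g c K) : CharacterVarietyPoints G n g c :=
  (eval x).comp (invariants G n g c).val

theorem toQuotient_glConj (hn : n ≠ 0) (h : GeneralLinearGroup (Fin n) K)
    (x : TwistedRep G n g c K) : toQuotient (glConj h x) = toQuotient x :=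
  AlgHom.ext fun f =>
    eval_eq_of_conj hn x _ h.val h⁻¹.val (Units.mul_inv h) (fun _ => rep_glConj h x _) f f.2

/-- The scalar matrices. -/
def scalarUnit (n : ℕ) (a : Kˣ) : GeneralLinearGroup (Fin n) K :=
  Units.map (algebraMap K (Matrix (Fin n) (Fin n) K)).toMonoidHom a

theorem glConj_scalarUnit_mul (a : Kˣ) (h : GeneralLinearGroup (Fin n) K)
    (x : TwistedRep G n g c K) : glConj (scalarUnit n a * h) x = glConj h x := by
  refine ext_rep fun s => ?_
  rw [rep_glConj, rep_glConj, _root_.mul_inv_rev, Units.val_mul, Units.val_mul]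
  have h1 : ∀ A : Matrix (Fin n) (Fin n) K,
      (scalarUnit n a).val * A * (scalarUnit n a)⁻¹.val = A := by
    intro A
    have : (scalarUnit n a).val * A = A * (scalarUnit n a).val :=
      Algebra.commutes (a : K) A
    rw [this, mul_assoc, Units.mul_inv, mul_one]
  rw [← h1 (h.val * _ * h⁻¹.val)]
  simp only [mul_assoc]

theorem card_generalLinearGroup (hn : n ≠ 0) :
    Nat.card (GeneralLinearGroup (Fin n) K) = Nat.card (LinGroup.SL.points n K) * Nat.card Kˣ := by
  have hsurj : Function.Surjective (GeneralLinearGroup.det (n := Fin n) (R := K)) := by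
    have : NeZero n := ⟨hn⟩
    exact GeneralLinearGroup.det_surjective
  rw [← Subgroup.card_mul_index (LinGroup.SL.points n K)]
  congr 1
  change (MonoidHom.ker _).index = _
  rw [Subgroup.index_ker, MonoidHom.range_eq_top.mpr hsurj, Subgroup.card_top]

variable [Finite K]

theorem exists_glConj_eq (hn : n ≠ 0) (hc : ∀ m : ℕ, c ^ m = 1 → n ∣ m)
    {x y : TwistedRep G n g c K} (h : toQuotient x = toQuotient y) : ∃ k, glConj k x = y := by
  obtain ⟨P, Q, hPQ, hP⟩ := exists_conj_of_eval_eq hn hc h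
  refine ⟨⟨P, Q, hPQ, mul_eq_one_comm.mp hPQ⟩, ext_rep fun s => ?_⟩
  rw [rep_glConj, hP]
  rfl

/-- h k⁻¹ commutes with an absolutely irreducible representation, so Schur's lemma makes it scalar.
-/
theorem eq_scalarUnit_mul_of_glConj_eq (hn : n ≠ 0) (hc : ∀ m : ℕ, c ^ m = 1 → n ∣ m)
    {h k : GeneralLinearGroup (Fin n) K} {x : TwistedRep G n g c K}
    (e : glConj h x = glConj k x) : ∃ a, h = scalarUnit n a * k := by
  have : NeZero n := ⟨hn⟩
  have hcomm : ∀ γ, (h * k⁻¹).val * (glConj k x).rep γ = (glConj k x).rep γ * (h * k⁻¹).val := by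
    intro γ
    conv_rhs => rw [← e]
    rw [rep_glConj, rep_glConj, Units.val_mul]
    simp only [mul_assoc, Units.inv_mul_cancel_left]
  obtain ⟨a, ha⟩ := exists_eq_smul_one_of_commute
    (span_range_rep_eq_top (Or.inr ‹_›) hn hc (glConj k x)) hcomm
  have ha0 : a ≠ 0 := by
    rintro rfl
    rw [zero_smul] at ha
    exact (h * k⁻¹).ne_zero ha
  refine ⟨Units.mk0 a ha0, ?_⟩
  rw [← mul_inv_eq_iff_eq_mul]
  apply Units.ext
  rw [ha, ← Algebra.algebraMap_eq_smul_one]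
  rfl

instance finite_twistedRep : Finite (TwistedRep G n g c K) :=
  Subtype.finite (α := Fin g ⊕ Fin g → G.points n K)

theorem finite_characterVarietyPoints (hn : n ≠ 0) (hc : ∀ m : ℕ, c ^ m = 1 → n ∣ m) :
    Finite (CharacterVarietyPoints G n g c) :=
  Finite.of_surjective (toQuotient (G := G) (n := n) (g := g) (c := c))
    (exists_rational_point hn hc)

/-- Each fibre of U(K) over the quotient is one `GL(n, K)`-orbit with stabilizer Kˣ. -/
theorem card_units_mul_card_twistedRep (hn : n ≠ 0) (hc : ∀ m : ℕ, c ^ m = 1 → n ∣ m) :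
    Nat.card Kˣ * Nat.card (TwistedRep G n g c K) =
      Nat.card (GeneralLinearGroup (Fin n) K) * Nat.card (CharacterVarietyPoints G n g c) := by
  choose σ hσ using exists_rational_point (G := G) (g := g) hn hc
  have hσ' : ∀ φ, toQuotient (σ φ) = φ := hσ
  choose k hk using fun x : TwistedRep G n g c K =>
    exists_glConj_eq hn hc (hσ' (toQuotient x))
  rw [← Nat.card_prod, ← Nat.card_prod]
  -- σ picks a point in each fibre and k(x) carries it to x, so a scalar times k(x) ranges over all
  -- elements that do so.
  refine Nat.card_congr (Equiv.ofBijective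
    (fun p : Kˣ × TwistedRep G n g c K => (scalarUnit n p.1 * k p.2, toQuotient p.2)) ⟨?_, ?_⟩)
  · rintro ⟨a, x⟩ ⟨b, y⟩ h
    obtain ⟨h1, h2⟩ := Prod.mk.inj h
    dsimp only at h1 h2
    have hxy : x = y := by
      rw [← hk x, ← hk y, ← glConj_scalarUnit_mul a, ← glConj_scalarUnit_mul b (k y), h1, h2]
    subst hxy
    have h3 := congrArg Units.val (mul_right_cancel h1)
    have : NeZero n := ⟨hn⟩
    have hab : (a : K) = b := (algebraMap K (Matrix (Fin n) (Fin n) K)).injective h3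
    rw [Units.ext hab]
  · rintro ⟨h, φ⟩
    have hq : toQuotient (glConj h (σ φ)) = φ := by rw [toQuotient_glConj hn, hσ']
    have h1 := hk (glConj h (σ φ))
    rw [hq] at h1
    obtain ⟨a, ha⟩ := eq_scalarUnit_mul_of_glConj_eq hn hc h1.symm
    exact ⟨(a, glConj h (σ φ)), Prod.ext ha.symm hq⟩

theorem card_characterVarietyPoints_SL (hn : n ≠ 0) (hc : ∀ m : ℕ, c ^ m = 1 → n ∣ m) :
    (Nat.card (CharacterVarietyPoints .SL n g c) : ℂ) =
      Nat.card (TwistedRep .SL n g c K) / Nat.card (LinGroup.SL.points n K) := by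
  have h := card_units_mul_card_twistedRep (G := .SL) (g := g) hn hc
  rw [card_generalLinearGroup hn, mul_comm (Nat.card (LinGroup.SL.points n K)), mul_assoc] at h
  have h1 := Nat.eq_of_mul_eq_mul_left Nat.card_pos h
  rw [eq_div_iff (Nat.cast_ne_zero.mpr Nat.card_pos.ne'), h1, mul_comm, Nat.cast_mul]

theorem card_characterVarietyPoints_GL (hn : n ≠ 0) (hc : ∀ m : ℕ, c ^ m = 1 → n ∣ m) :
    (Nat.card (CharacterVarietyPoints .GL n g c) : ℂ) = (Nat.card K - 1) *
      (Nat.card (TwistedRep .GL n g c K) / Nat.card (LinGroup.GL.points n K)) := by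
  have h := card_units_mul_card_twistedRep (G := .GL) (g := g) hn hc
  have h1 : Nat.card (LinGroup.GL.points n K) = Nat.card (GeneralLinearGroup (Fin n) K) :=
    Subgroup.card_top
  have h2 : (Nat.card Kˣ : ℂ) = Nat.card K - 1 := by
    rw [Nat.card_units, Nat.cast_sub Nat.card_pos, Nat.cast_one]
  rw [← h1] at h
  rw [← mul_div_assoc, eq_div_iff (Nat.cast_ne_zero.mpr Nat.card_pos.ne'), ← h2, mul_comm]
  exact_mod_cast h.symm

end Count

/-! ### Frobenius' formula for the number of solutions of the surface equation -/

section Frobenius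

open Representation

/-- The distributive law, with the order of the factors kept because it is applied in an
endomorphism ring. -/
theorem sum_list_prod_ofFn {α M : Type*} [Fintype α] [Semiring M] (f : α → M) (g : ℕ) :
    ∑ x : Fin g → α, (List.ofFn fun i => f (x i)).prod = (∑ a, f a) ^ g := by
  induction g with
  | zero => simp
  | succ g ih =>
    rw [pow_succ', ← ih, Finset.sum_mul_sum, ← Fintype.sum_prod_type',
      ← (Fin.consEquiv fun _ => α).sum_comp]
    refine Finset.sum_congr rfl fun p _ => ?_
    rw [List.ofFn_succ, List.prod_cons]
    rfl

/-! ### Schur's lemma and sums of an irreducible representation over the group. -/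

section Irreducible

variable {Γ : Type v} [Group Γ] {m : ℕ} (ρ : Representation ℂ Γ (Fin m → ℂ))

theorem eq_smul_one_of_commute [hρ : ρ.IsIrreducible] (T : Module.End ℂ (Fin m → ℂ))
    (hT : ∀ a, T * ρ a = ρ a * T) :
    T = (LinearMap.trace ℂ _ T / m) • (1 : Module.End ℂ (Fin m → ℂ)) := by
  let f : IntertwiningMap ρ ρ := ⟨T, hT⟩
  obtain ⟨t, ht⟩ :=
    (IsIrreducible.algebraMap_intertwiningMap_bijective_of_isAlgClosed (ρ := ρ)).2 f
  have hTt : T = t • (1 : Module.End ℂ (Fin m → ℂ)) := by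
    refine LinearMap.ext fun v => ?_
    exact (DFunLike.congr_fun ht v).symm
  rcases Nat.eq_zero_or_pos m with rfl | hm
  · exact Subsingleton.elim _ _
  · have hm' : (m : ℂ) ≠ 0 := Nat.cast_ne_zero.mpr hm.ne'
    have htr : LinearMap.trace ℂ _ T = t * m := by
      rw [hTt, map_smul, LinearMap.trace_one, Module.finrank_fin_fun, smul_eq_mul]
    rw [htr, mul_div_cancel_right₀ _ hm', ← hTt]

theorem character_one_eq : ρ.character 1 = m := by
  rw [char_one, Module.finrank_fin_fun]

variable [Fintype Γ]

theorem card_complex_ne_zero : (Nat.card Γ : ℂ) ≠ 0 := Nat.cast_ne_zero.mpr Nat.card_pos.ne'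

theorem sum_irr_mul_inv {σ τ : Γ → ℂ} (hσ : σ ∈ Irr Γ) (hτ : τ ∈ Irr Γ) [Decidable (σ = τ)] :
    ∑ a, σ a * τ a⁻¹ = if σ = τ then (Nat.card Γ : ℂ) else 0 := by
  obtain ⟨m, ρ, hρ, rfl⟩ := hσ
  obtain ⟨m', ρ', hρ', rfl⟩ := hτ
  have hcard := card_complex_ne_zero (Γ := Γ)
  let _ : Invertible (Nat.card Γ : ℂ) := invertibleOfNonzero hcard
  have h := char_orthonormal ρ ρ'
  rw [inv_mul_eq_iff_eq_mul₀ hcard] at h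
  rw [h]
  by_cases hn : Nonempty (ρ'.Equiv ρ)
  · obtain ⟨φ⟩ := hn
    rw [if_pos ⟨φ⟩, if_pos (char_iso φ).symm, mul_one]
  · rw [if_neg hn, mul_zero, if_neg]
    -- Non-isomorphic representations with equal characters would make the norm of the character
    -- both 0 and |Γ|.
    intro hc
    have h2 := char_orthonormal ρ ρ
    rw [if_pos ⟨Representation.Equiv.refl ρ⟩, inv_mul_eq_iff_eq_mul₀ hcard] at h2
    rw [if_neg hn, mul_zero, ← hc, h2, mul_one] at h
    exact hcard h

theorem dim_ne_zero [hρ : ρ.IsIrreducible] : (m : ℂ) ≠ 0 := by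
  classical
  intro hm
  have h := sum_irr_mul_inv ⟨m, ρ, hρ, rfl⟩ ⟨m, ρ, hρ, rfl⟩
  rw [if_pos rfl] at h
  have hm' : m = 0 := Nat.cast_eq_zero.mp hm
  subst hm'
  apply card_complex_ne_zero (Γ := Γ)
  rw [← h]
  refine Finset.sum_eq_zero fun a _ => ?_
  have : ρ.character a = 0 := by
    rw [character, Subsingleton.elim (ρ a) 0, map_zero]
  rw [this, zero_mul]

/-- A class function gives a scalar operator. -/
theorem sum_smul_eq_smul_one [hρ : ρ.IsIrreducible] (f : Γ → ℂ)
    (hf : ∀ a b, f (a * b * a⁻¹) = f b) :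
    ∑ b, f b • ρ b⁻¹ = ((∑ b, f b * ρ.character b⁻¹) / m) • (1 : Module.End ℂ (Fin m → ℂ)) := by
  have h := eq_smul_one_of_commute ρ (∑ b, f b • ρ b⁻¹) (fun a => by
    rw [Finset.sum_mul, Finset.mul_sum, ← (MulAut.conj a).toEquiv.sum_comp]
    refine Finset.sum_congr rfl fun b _ => ?_
    have : ((MulAut.conj a).toEquiv b) = a * b * a⁻¹ := rfl
    rw [this, hf, smul_mul_assoc, mul_smul_comm, ← map_mul, ← map_mul]
    congr 2
    group)
  rw [map_sum] at h
  simpa only [map_smul, smul_eq_mul, character] using h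

theorem sum_conj_eq [hρ : ρ.IsIrreducible] (b : Γ) :
    ∑ a, ρ (a * b * a⁻¹) =
      ((Nat.card Γ : ℂ) * ρ.character b / m) • (1 : Module.End ℂ (Fin m → ℂ)) := by
  have h := eq_smul_one_of_commute ρ (∑ a, ρ (a * b * a⁻¹)) (fun c => by
    rw [Finset.sum_mul, Finset.mul_sum,
      ← _root_.Equiv.sum_comp (_root_.Equiv.mulLeft c) fun a => ρ (a * b * a⁻¹) * ρ c]
    refine Finset.sum_congr rfl fun a _ => ?_
    rw [_root_.Equiv.coe_mulLeft, ← map_mul, ← map_mul]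
    congr 1
    group)
  have htr : LinearMap.trace ℂ _ (∑ a, ρ (a * b * a⁻¹)) = (Nat.card Γ : ℂ) * ρ.character b := by
    have : ∀ a, LinearMap.trace ℂ _ (ρ (a * b * a⁻¹)) = ρ.character b := ρ.char_conj b
    rw [map_sum, Finset.sum_congr rfl fun a _ => this a, Finset.sum_const, Finset.card_univ,
      nsmul_eq_mul, Nat.card_eq_fintype_card]
  rwa [htr] at h

/-- Summing over a with b fixed gives a multiple of χ(b) ρ(b⁻¹). Summing this over b gives a scalar
with ∑ χ(b) χ(b⁻¹) = |Γ|. -/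
theorem sum_commutator_eq [hρ : ρ.IsIrreducible] :
    ∑ p : Γ × Γ, ρ (p.1 * p.2 * p.1⁻¹ * p.2⁻¹) =
      ((Nat.card Γ : ℂ) / m) ^ 2 • (1 : Module.End ℂ (Fin m → ℂ)) := by
  classical
  rw [Fintype.sum_prod_type_right]
  have h1 : ∀ b, ∑ a, ρ (a * b * a⁻¹ * b⁻¹) =
      ((Nat.card Γ : ℂ) / m) • (ρ.character b • ρ b⁻¹) := by
    intro b
    simp only [map_mul ρ _ b⁻¹]
    rw [← Finset.sum_mul, sum_conj_eq, smul_mul_assoc, one_mul, smul_smul, mul_div_right_comm]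
  rw [Finset.sum_congr rfl fun b _ => h1 b, ← Finset.smul_sum,
    sum_smul_eq_smul_one ρ ρ.character fun a b => ρ.char_conj b a,
    sum_irr_mul_inv ⟨m, ρ, hρ, rfl⟩ ⟨m, ρ, hρ, rfl⟩, if_pos rfl, smul_smul, sq]

theorem sum_surfaceWord_eq [hρ : ρ.IsIrreducible] (g : ℕ) :
    ∑ x : Fin g ⊕ Fin g → Γ, ρ (surfaceWord x) =
      ((Nat.card Γ : ℂ) / m) ^ (2 * g) • (1 : Module.End ℂ (Fin m → ℂ)) := by
  rw [pow_mul, ← one_pow (M := Module.End ℂ (Fin m → ℂ)) g, ← smul_pow, ← sum_commutator_eq ρ,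
    ← sum_list_prod_ofFn]
  let e : (Fin g ⊕ Fin g → Γ) ≃ (Fin g → Γ × Γ) :=
    (_root_.Equiv.sumArrowEquivProdArrow _ _ _).trans
      (_root_.Equiv.arrowProdEquivProdArrow _ (fun _ => Γ) (fun _ => Γ)).symm
  rw [← e.sum_comp]
  refine Finset.sum_congr rfl fun x _ => ?_
  rw [surfaceWord, map_list_prod, List.map_ofFn]
  rfl

end Irreducible

/-! ### Completeness of the irreducible characters and the count of solutions. -/

variable {Γ : Type v} [Group Γ]

/-- The representation is the simple module ℂ[Γ]/M in coordinates. An element acting as zero kills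
the class of 1, hence lies in M. -/
theorem isIrreducible_quotient [Fintype Γ] (M : Ideal (MonoidAlgebra ℂ Γ)) (hM : IsCoatom M) :
    ∃ (m : ℕ) (ρ : Representation ℂ Γ (Fin m → ℂ)), ρ.IsIrreducible ∧
      ∀ r, ρ.asAlgebraHom r = 0 → r ∈ M := by
  let Q := MonoidAlgebra ℂ Γ ⧸ M
  have : Module.Finite ℂ Q := inferInstance
  let e : Q ≃ₗ[ℂ] (Fin (Module.finrank ℂ Q) → ℂ) := (Module.finBasis ℂ Q).equivFun
  let l : MonoidAlgebra ℂ Γ →ₐ[ℂ] Module.End ℂ (Fin (Module.finrank ℂ Q) → ℂ) :=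
    (e.conjAlgEquiv ℂ).toAlgHom.comp (Algebra.lsmul ℂ ℂ Q)
  let ρ : Representation ℂ Γ (Fin (Module.finrank ℂ Q) → ℂ) :=
    (l : MonoidAlgebra ℂ Γ →* Module.End ℂ (Fin (Module.finrank ℂ Q) → ℂ)).comp
      (MonoidAlgebra.of ℂ Γ)
  have hl : ρ.asAlgebraHom = l := by
    refine MonoidAlgebra.algHom_ext (fun a => ?_) (Subsingleton.elim _ _)
    rw [asAlgebraHom_single_one]
    rfl
  have hle : ∀ r y, e.symm (l r y) = r • e.symm y := fun r y => e.symm_apply_apply _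
  let E : ρ.asModule ≃ₗ[MonoidAlgebra ℂ Γ] Q :=
    { (ρ.asModuleEquiv.trans e.symm).toAddEquiv with
      map_smul' := fun r x => by
        change e.symm (ρ.asModuleEquiv (r • x)) = r • e.symm (ρ.asModuleEquiv x)
        rw [asModuleEquiv_map_smul, hl, hle] }
  have hQ : IsSimpleModule (MonoidAlgebra ℂ Γ) Q := isSimpleModule_iff_isCoatom.mpr hM
  refine ⟨_, ρ, (irreducible_iff_isSimpleModule_asModule ρ).mpr (IsSimpleModule.congr E),
    fun r hr => ?_⟩
  have h1 := hle r (e (Submodule.Quotient.mk 1))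
  rw [← hl, hr, LinearMap.zero_apply, map_zero, e.symm_apply_apply, ← Submodule.Quotient.mk_smul,
    smul_eq_mul, mul_one] at h1
  exact (Submodule.Quotient.mk_eq_zero M).mp h1.symm

/-- Class functions orthogonal to all irreducible characters vanish. -/
theorem eq_zero_of_orthogonal_irr [Fintype Γ] (f : Γ → ℂ) (hf : ∀ a b, f (a * b * a⁻¹) = f b)
    (h : ∀ χ ∈ Irr Γ, ∑ b, f b * χ b⁻¹ = 0) : f = 0 := by
  have : NeZero (Nat.card Γ : ℂ) := ⟨card_complex_ne_zero⟩
  -- This element acts by a scalar on each irreducible representation, and orthogonality makes the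
  -- scalar 0. So it lies in the Jacobson radical, which vanishes by Maschke's theorem.
  let r : MonoidAlgebra ℂ Γ := ∑ b, MonoidAlgebra.single b⁻¹ (f b)
  have hr : r ∈ Ring.jacobson (MonoidAlgebra ℂ Γ) := by
    refine Ideal.mem_sInf.mpr fun {M} hM => ?_
    obtain ⟨m, ρ, hρ, hρM⟩ := isIrreducible_quotient M hM
    apply hρM
    rw [map_sum]
    simp only [asAlgebraHom_single]
    rw [sum_smul_eq_smul_one ρ f hf, h _ ⟨m, ρ, hρ, rfl⟩, zero_div, zero_smul]
  rw [IsSemisimpleRing.jacobson_eq_bot, Ideal.mem_bot] at hr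
  funext a
  classical
  have ha : r.coeff a⁻¹ = f a := by
    simp [r, MonoidAlgebra.coeff_sum, Finsupp.single_apply]
  rw [← ha, hr]
  rfl

/-- The difference of the two sides is a class function orthogonal to every irreducible character.
-/
theorem sum_irr_regular [Finite Γ] (h : Γ) [Decidable (h = 1)] :
    ∑ χ ∈ (irr_finite Γ).toFinset, χ 1 * χ h = if h = 1 then (Nat.card Γ : ℂ) else 0 := by
  classical
  have := Fintype.ofFinite Γ
  let f : Γ → ℂ := fun h => (∑ χ ∈ (irr_finite Γ).toFinset, χ 1 * χ h) -
    if h = 1 then (Nat.card Γ : ℂ) else 0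
  have hf : f = 0 := by
    apply eq_zero_of_orthogonal_irr
    · intro a b
      have h1 : a * b * a⁻¹ = 1 ↔ b = 1 := by
        rw [mul_inv_eq_one, mul_eq_left]
      simp only [f, h1]
      congr 1
      refine Finset.sum_congr rfl fun χ hχ => ?_
      obtain ⟨m, ρ, hρ, rfl⟩ := (irr_finite Γ).mem_toFinset.mp hχ
      rw [char_conj]
    · intro τ hτ
      simp only [f, sub_mul, Finset.sum_sub_distrib, Finset.sum_mul, ite_mul, zero_mul]
      rw [Finset.sum_comm, Finset.sum_ite_eq' Finset.univ (1 : Γ), if_pos (Finset.mem_univ _),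
        Finset.sum_eq_single τ]
      · simp only [mul_assoc]
        rw [← Finset.mul_sum, sum_irr_mul_inv hτ hτ, if_pos rfl, inv_one, mul_comm, sub_self]
      · intro χ hχ hne
        simp only [mul_assoc]
        rw [← Finset.mul_sum, sum_irr_mul_inv ((irr_finite Γ).mem_toFinset.mp hχ) hτ,
          if_neg hne, mul_zero]
      · intro hc
        exact absurd ((irr_finite Γ).mem_toFinset.mpr hτ) hc
  have h2 : f h = 0 := congrFun hf h
  simp only [f, sub_eq_zero] at h2
  rw [h2]
  congr 1

/-- Since [A, B]⁻¹ = [B, A], swapping each Aᵢ with Bᵢ and reversing the order of the indices inverts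
the word. -/
theorem card_surfaceWord_inv {g : ℕ} (z : Γ) :
    Nat.card {x : Fin g ⊕ Fin g → Γ // surfaceWord x = z⁻¹} =
      Nat.card {x : Fin g ⊕ Fin g → Γ // surfaceWord x = z} := by
  let e : (Fin g ⊕ Fin g → Γ) ≃ (Fin g ⊕ Fin g → Γ) :=
    ((_root_.Equiv.sumCongr Fin.revPerm Fin.revPerm).trans (_root_.Equiv.sumComm _ _)).arrowCongr
      (_root_.Equiv.refl Γ)
  refine Nat.card_congr (e.subtypeEquiv fun x => ?_)
  have : surfaceWord (e x) = (surfaceWord x)⁻¹ := by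
    rw [surfaceWord, surfaceWord, List.prod_inv_reverse, List.map_ofFn]
    congr 1
    refine List.ext_getElem (by simp) fun i h1 h2 => ?_
    have h3 : i < g := by simpa using h1
    have h4 : (⟨g - 1 - i, by omega⟩ : Fin g) = Fin.rev ⟨i, h3⟩ := by
      ext
      simp only [Fin.val_rev]
      omega
    simp only [List.getElem_ofFn, List.getElem_reverse, List.length_ofFn, h4]
    simp [e, mul_assoc]
  rw [this, inv_eq_iff_eq_inv]

/-- Frobenius' formula. -/
theorem card_surfaceWord_div [Finite Γ] (g : ℕ) (z : Γ) :
    (Nat.card {x : Fin g ⊕ Fin g → Γ // surfaceWord x = z} : ℂ) / Nat.card Γ =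
      characterSum Γ g z := by
  classical
  have := Fintype.ofFinite Γ
  have hcard := card_complex_ne_zero (Γ := Γ)
  -- The regular character at w(x) z detects w(x) = z⁻¹. This form keeps χ(z) without complex
  -- conjugation; the passage from z⁻¹ to z is `card_surfaceWord_inv`.
  have h1 : (Nat.card Γ : ℂ) * Nat.card {x : Fin g ⊕ Fin g → Γ // surfaceWord x = z⁻¹} =
      ∑ x : Fin g ⊕ Fin g → Γ, ∑ χ ∈ (irr_finite Γ).toFinset, χ 1 * χ (surfaceWord x * z) := by
    simp only [sum_irr_regular, mul_eq_one_iff_eq_inv]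
    rw [Finset.sum_ite, Finset.sum_const_zero, add_zero, Finset.sum_const, nsmul_eq_mul,
      mul_comm, Nat.card_eq_fintype_card, Fintype.card_subtype]
  have h2 : ∀ χ ∈ (irr_finite Γ).toFinset,
      ∑ x : Fin g ⊕ Fin g → Γ, χ 1 * χ (surfaceWord x * z) =
        (Nat.card Γ : ℂ) ^ 2 * ((Nat.card Γ : ℂ) ^ (2 * (g : ℤ) - 2) /
          χ 1 ^ (2 * (g : ℤ) - 1) * χ z) := by
    intro χ hχ
    obtain ⟨m, ρ, hρ, rfl⟩ := (irr_finite Γ).mem_toFinset.mp hχ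
    have hm := dim_ne_zero ρ
    have h3 : ∑ x : Fin g ⊕ Fin g → Γ, ρ.character (surfaceWord x * z) =
        ((Nat.card Γ : ℂ) / m) ^ (2 * g) * ρ.character z := by
      have h4 := congrArg (fun T => LinearMap.trace ℂ _ (T * ρ z)) (sum_surfaceWord_eq ρ g)
      simp only [Finset.sum_mul, map_sum, smul_mul_assoc, one_mul, map_smul, smul_eq_mul,
        ← map_mul] at h4
      exact h4
    rw [← Finset.mul_sum, h3, character_one_eq, zpow_sub₀ hcard, zpow_sub₀ hm, div_pow, zpow_one,
      ← zpow_natCast, ← zpow_natCast]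
    push_cast
    have h5 : (m : ℂ) ^ (2 * (g : ℤ)) ≠ 0 := zpow_ne_zero _ hm
    have h6 : (Nat.card Γ : ℂ) ^ (2 : ℤ) = (Nat.card Γ : ℂ) ^ 2 := by norm_cast
    rw [h6]
    field_simp
  rw [← card_surfaceWord_inv, div_eq_iff hcard, characterSum, ← mul_right_inj' hcard, h1,
    Finset.sum_comm, Finset.sum_congr rfl h2, ← Finset.mul_sum]
  ring

end Frobenius

theorem card_twistedRep_div {K : Type u} [Field K] [Finite K] {G : LinGroup} {n g : ℕ} {c : K}
    (ξ : G.points n K) (hξ : LinGroup.mat ξ = Matrix.scalar (Fin n) c) :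
    (Nat.card (TwistedRep G n g c K) : ℂ) / Nat.card (G.points n K) =
      characterSum (G.points n K) g ξ := by
  rw [← card_surfaceWord_div]
  congr 2
  refine Nat.card_congr (Equiv.subtypeEquivRight fun x => ?_)
  rw [Algebra.algebraMap_self, RingHom.id_apply, ← hξ]
  exact LinGroup.mat_injective.eq_iff

theorem dvd_of_zpow_pow_eq_one {K : Type*} [Field K] {n : ℕ} {ζ : K} (hζ : IsPrimitiveRoot ζ n)
    {d : ℤ} (hd : IsCoprime d (n : ℤ)) (m : ℕ) (h : (ζ ^ d) ^ m = 1) : n ∣ m := by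
  rw [← zpow_natCast, ← _root_.zpow_mul, hζ.zpow_eq_one_iff_dvd] at h
  exact Int.natCast_dvd_natCast.mp (hd.symm.dvd_of_dvd_mul_left h)

end CharVar

theorem mainTheorem5 {K : Type*} [Field K] [Finite K] (n g : ℕ) (hn : n ∣ Nat.card K - 1)
    (ζ : K) (hζ : IsPrimitiveRoot ζ n) (d : ℤ) (hd : IsCoprime d (n : ℤ)) :
    -- the affine GIT quotient for `SL(n)`
    (∀ ξ : CharVar.LinGroup.SL.points n K,
      CharVar.LinGroup.mat ξ = Matrix.scalar (Fin n) (ζ ^ d) →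
        Finite (CharVar.CharacterVarietyPoints .SL n g (ζ ^ d)) ∧
        (Nat.card (CharVar.CharacterVarietyPoints .SL n g (ζ ^ d)) : ℂ) =
          CharVar.characterSum (CharVar.LinGroup.SL.points n K) g ξ) ∧
    -- the affine GIT quotient for `GL(n)`
    (∀ ξ : CharVar.LinGroup.GL.points n K,
      CharVar.LinGroup.mat ξ = Matrix.scalar (Fin n) (ζ ^ d) →
        Finite (CharVar.CharacterVarietyPoints .GL n g (ζ ^ d)) ∧
        (Nat.card (CharVar.CharacterVarietyPoints .GL n g (ζ ^ d)) : ℂ) =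
          ((Nat.card K : ℂ) - 1) *
            CharVar.characterSum (CharVar.LinGroup.GL.points n K) g ξ) ∧
    -- for both groups, the number of solutions in `G(K)` divided by the order of `G(K)`
    (∀ (G : CharVar.LinGroup) (ξ : G.points n K),
      CharVar.LinGroup.mat ξ = Matrix.scalar (Fin n) (ζ ^ d) →
        (Nat.card (CharVar.TwistedRep G n g (ζ ^ d) K) : ℂ) / Nat.card (G.points n K) =
          CharVar.characterSum (G.points n K) g ξ) := by
  -- n = 0 would divide q - 1 only if q - 1 = 0, but a field has at least two elements.
  have hn0 : n ≠ 0 := by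
    rintro rfl
    have h1 := Nat.eq_zero_of_zero_dvd hn
    have h2 := Finite.one_lt_card (α := K)
    omega
  have hc := CharVar.dvd_of_zpow_pow_eq_one hζ hd
  refine ⟨fun ξ hξ => ⟨CharVar.finite_characterVarietyPoints hn0 hc, ?_⟩,
    fun ξ hξ => ⟨CharVar.finite_characterVarietyPoints hn0 hc, ?_⟩,
    fun G ξ hξ => CharVar.card_twistedRep_div ξ hξ⟩
  · rw [CharVar.card_characterVarietyPoints_SL hn0 hc, CharVar.card_twistedRep_div ξ hξ]
  · rw [CharVar.card_characterVarietyPoints_GL hn0 hc, CharVar.card_twistedRep_div ξ hξ]
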